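/- **Setting.** Let $m\ge 1$ and let $\Omega\subset\mathbb R^{m+1}$ be a domain. Let $a^{ij}(x,p)$ ($1\le i,j\le m+1$) be $C^\infty$ functions on $\Omega\times\mathbb R^{m+1}$ and $b(x,z,p)$ a $C^\infty$ function on $\Omega\times\mathbb R\times\mathbb R^{m+1}$ such that (1) $a^{ij}=a^{ji}$ and $(a^{ij})$ is nonnegative, i.e. $\sum_{i,j}a^{ij}(x,p)\xi_i\xi_j\ge 0$ for all $(x,p)\in\Omega\times\mathbb R^{m+1}$ and $\xi\in\mathbb R^{m+1}$; (2) $\partial b/\partial z\le 0$. For $C^\infty$ vector fields $X_1,\dots,X_r$ on $\Omega$ let $\mathcal L(X_1,\dots,X_r)$ be the smallest $C^\infty(\Omega)$-module of vector fields on $\Omega$ that contains $X_1,\dots,X_r$ and is closed under the Lie bracket. For a function $w$ on $\Omega$ we say that *maxima of $w$ propagate along $\mathcal L(X_1,\dots,X_r)$* if the following holds: whenever $\Gamma\subset\Omega$ is an integral curve of some $Z\in\mathcal L(X_1,\dots,X_r)$ and $w$ achieves a nonnegative maximum over $\Omega$ at a point of $\Gamma$, this maximum is attained at all points of $\Gamma$.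 Repeated indices $i,j$ are summed from $1$ to $m+1$. **Theorem A.** Let $Q\varphi=a^{ij}(x,D\varphi)D_{ij}\varphi+b(x,\varphi,D\varphi)$. Let $\varphi,\psi\in C^\infty(\Omega)$ satisfy $Q\varphi\ge Q\psi$ in $\Omega$, and let $X_1,\dots,X_r,Y$ be $C^\infty$ vector fields on $\Omega$ (which may depend on $\varphi$) such that $$(3)\qquad a^{ij}(x,D\varphi(x))\,D_{ij}=\sum_{k=1}^r X_k^2+Y$$ as differential operators on $\Omega$. Then maxima of $\varphi-\psi$ propagate along $\mathcal L(X_1,\dots,X_r)$. **Theorem A′.** Let $e_1,\dots,e_{m+1}$ be $C^\infty$ vector fields on $\Omega$, linearly independent at every point, and let $$Q'\varphi=a^{ij}(x,e_1\varphi,\dots,e_{m+1}\varphi)\,e_ie_j\varphi+b(x,\varphi,e_1\varphi,\dots,e_{m+1}\varphi).$$ Let $\varphi,\psi\in C^\infty(\Omega)$ satisfy $Q'\varphi\ge Q'\psi$ in $\Omega$, and let $X_1,\dots,X_r,Y$ be $C^\infty$ vector fields on $\Omega$ (which may depend on $\varphi$) such that $$(3')\qquad a^{ij}(x,e_1\varphi(x),\dots,e_{m+1}\varphi(x))\,e_ie_j=\sum_{k=1}^r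 X_k^2+Y$$ as differential operators on $\Omega$. Then maxima of $\varphi-\psi$ propagate along $\mathcal L(X_1,\dots,X_r)$. **Theorem Ã.** Theorem A (respectively A′) holds with condition (3) (respectively (3′)) replaced by the condition that the matrix $\tilde a^{ij}(x)=a^{ij}(x,D\varphi(x))$ (respectively $\tilde a^{ij}(x)=a^{ij}(x,e_1\varphi(x),\dots,e_{m+1}\varphi(x))$) has constant rank on $\Omega$. That is: if $\varphi\in C^\infty(\Omega)$ and $(\tilde a^{ij}(x))$ has constant rank on $\Omega$, then there exist $C^\infty$ vector fields $X_1,\dots,X_r,Y$ on $\Omega$ satisfying (3) (respectively (3′)) such that, for every $\psi\in C^\infty(\Omega)$ with $Q\varphi\ge Q\psi$ (respectively $Q'\varphi\ge Q'\psi$) in $\Omega$, maxima of $\varphi-\psi$ propagate along $\mathcal L(X_1,\dots,X_r)$. -/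

import Mathlib

open scoped ContDiff

/-- The action of a vector field `X` on a function `f`: `(X f)(x) = df_x (X(x))`. -/
noncomputable def fieldDeriv {n : ℕ}
    (X : EuclideanSpace ℝ (Fin n) → EuclideanSpace ℝ (Fin n))
    (f : EuclideanSpace ℝ (Fin n) → ℝ) : EuclideanSpace ℝ (Fin n) → ℝ :=
  fun x => fderiv ℝ f x (X x)

/-- The coordinate frame `∂/∂x¹, …, ∂/∂xⁿ`. -/
noncomputable def coordFrame (n : ℕ) :
    Fin n → EuclideanSpace ℝ (Fin n) → EuclideanSpace ℝ (Fin n) :=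
  fun i _ => EuclideanSpace.single i (1 : ℝ)

/-- `e` is a `C^∞` moving frame on `Ω`: smooth vector fields, independent at each point. -/
def IsSmoothFrame {n : ℕ} (Ω : Set (EuclideanSpace ℝ (Fin n)))
    (e : Fin n → EuclideanSpace ℝ (Fin n) → EuclideanSpace ℝ (Fin n)) : Prop :=
  (∀ i, ContDiffOn ℝ ∞ (e i) Ω) ∧ ∀ x ∈ Ω, LinearIndependent ℝ (fun i => e i x)

/-- The vector `(e₁φ(x), …, eₙφ(x))`; for the coordinate frame this is `Dφ(x)`. -/
noncomputable def frameGradient {n : ℕ}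
    (e : Fin n → EuclideanSpace ℝ (Fin n) → EuclideanSpace ℝ (Fin n))
    (φ : EuclideanSpace ℝ (Fin n) → ℝ) (x : EuclideanSpace ℝ (Fin n)) : Fin n → ℝ :=
  fun i => fieldDeriv (e i) φ x

/-- The coefficient matrix `ã^{ij}(x) = a^{ij}(x, e₁φ(x), …, eₙφ(x))`. -/
noncomputable def frozenCoeff {n : ℕ}
    (e : Fin n → EuclideanSpace ℝ (Fin n) → EuclideanSpace ℝ (Fin n))
    (a : EuclideanSpace ℝ (Fin n) → (Fin n → ℝ) → Matrix (Fin n) (Fin n) ℝ)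
    (φ : EuclideanSpace ℝ (Fin n) → ℝ) (x : EuclideanSpace ℝ (Fin n)) :
    Matrix (Fin n) (Fin n) ℝ :=
  a x (frameGradient e φ x)

/-- The operator `A^{ij}(x) eᵢ eⱼ f` for a matrix-valued function `A`. -/
noncomputable def secondOrderPart {n : ℕ}
    (e : Fin n → EuclideanSpace ℝ (Fin n) → EuclideanSpace ℝ (Fin n))
    (A : EuclideanSpace ℝ (Fin n) → Matrix (Fin n) (Fin n) ℝ)
    (f : EuclideanSpace ℝ (Fin n) → ℝ) (x : EuclideanSpace ℝ (Fin n)) : ℝ :=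
  ∑ i, ∑ j, A x i j * fieldDeriv (e i) (fieldDeriv (e j) f) x

/-- The quasilinear operator
`a^{ij}(x, e₁φ, …, eₙφ) eᵢ eⱼ φ + b(x, φ, e₁φ, …, eₙφ)`. -/
noncomputable def frameQuasilinearOp {n : ℕ}
    (e : Fin n → EuclideanSpace ℝ (Fin n) → EuclideanSpace ℝ (Fin n))
    (a : EuclideanSpace ℝ (Fin n) → (Fin n → ℝ) → Matrix (Fin n) (Fin n) ℝ)
    (b : EuclideanSpace ℝ (Fin n) → ℝ → (Fin n → ℝ) → ℝ)
    (φ : EuclideanSpace ℝ (Fin n) → ℝ) (x : EuclideanSpace ℝ (Fin n)) : ℝ :=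
  secondOrderPart e (frozenCoeff e a φ) φ x + b x (φ x) (frameGradient e φ x)

/-- The quasilinear operator `Qφ = a^{ij}(x, Dφ) D_{ij} φ + b(x, φ, Dφ)`. -/
noncomputable def quasilinearOp {n : ℕ}
    (a : EuclideanSpace ℝ (Fin n) → (Fin n → ℝ) → Matrix (Fin n) (Fin n) ℝ)
    (b : EuclideanSpace ℝ (Fin n) → ℝ → (Fin n → ℝ) → ℝ)
    (φ : EuclideanSpace ℝ (Fin n) → ℝ) (x : EuclideanSpace ℝ (Fin n)) : ℝ :=
  frameQuasilinearOp (coordFrame n) a b φ x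

/-- `X₁, …, X_r` and `Y` are `C^∞` vector fields on `Ω` with
`A^{ij}(x) eᵢ eⱼ = ∑ₖ Xₖ² + Y` as differential operators on `Ω`. -/
def IsSumOfSquares {n r : ℕ} (Ω : Set (EuclideanSpace ℝ (Fin n)))
    (e : Fin n → EuclideanSpace ℝ (Fin n) → EuclideanSpace ℝ (Fin n))
    (A : EuclideanSpace ℝ (Fin n) → Matrix (Fin n) (Fin n) ℝ)
    (X : Fin r → EuclideanSpace ℝ (Fin n) → EuclideanSpace ℝ (Fin n))
    (Y : EuclideanSpace ℝ (Fin n) → EuclideanSpace ℝ (Fin n)) : Prop :=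
  (∀ k, ContDiffOn ℝ ∞ (X k) Ω) ∧ ContDiffOn ℝ ∞ Y Ω ∧
    ∀ f : EuclideanSpace ℝ (Fin n) → ℝ, ContDiffOn ℝ ∞ f Ω → ∀ x ∈ Ω,
      secondOrderPart e A f x
        = ∑ k, fieldDeriv (X k) (fieldDeriv (X k) f) x + fieldDeriv Y f x

/-- `£(X₁, …, X_r)`: the smallest `C^∞(Ω)`-module of vector fields on `Ω` that contains
`X₁, …, X_r` and is closed under the Lie bracket. A vector field on `Ω` is represented by
any function on the whole space that agrees with it on `Ω` (clause `congr`). -/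
inductive LieSpan {n r : ℕ} (Ω : Set (EuclideanSpace ℝ (Fin n)))
    (X : Fin r → EuclideanSpace ℝ (Fin n) → EuclideanSpace ℝ (Fin n)) :
    (EuclideanSpace ℝ (Fin n) → EuclideanSpace ℝ (Fin n)) → Prop
  | gen (k : Fin r) : LieSpan Ω X (X k)
  | zero : LieSpan Ω X (fun _ => 0)
  | add {V W : EuclideanSpace ℝ (Fin n) → EuclideanSpace ℝ (Fin n)} :
      LieSpan Ω X V → LieSpan Ω X W →
      LieSpan Ω X (fun x => V x + W x)
  | smul {g : EuclideanSpace ℝ (Fin n) → ℝ}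
      {V : EuclideanSpace ℝ (Fin n) → EuclideanSpace ℝ (Fin n)} :
      ContDiffOn ℝ ∞ g Ω → LieSpan Ω X V →
      LieSpan Ω X (fun x => g x • V x)
  | bracket {V W : EuclideanSpace ℝ (Fin n) → EuclideanSpace ℝ (Fin n)} :
      LieSpan Ω X V → LieSpan Ω X W →
      LieSpan Ω X (VectorField.lieBracket ℝ V W)
  | congr {V W : EuclideanSpace ℝ (Fin n) → EuclideanSpace ℝ (Fin n)} :
      Set.EqOn V W Ω → LieSpan Ω X V → LieSpan Ω X W

/-- Let `Γ` be an integral curve in `Ω`, defined on an arbitrary interval `I`, of a vector field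
`Z ∈ £(X₁, …, X_r)`. If `w` achieves a nonnegative maximum over `Ω` at a point of `Γ`, then
that maximum is attained at all points of `Γ`. -/
def MaxPropagates {n r : ℕ} (Ω : Set (EuclideanSpace ℝ (Fin n)))
    (X : Fin r → EuclideanSpace ℝ (Fin n) → EuclideanSpace ℝ (Fin n))
    (w : EuclideanSpace ℝ (Fin n) → ℝ) : Prop :=
  ∀ Z : EuclideanSpace ℝ (Fin n) → EuclideanSpace ℝ (Fin n), LieSpan Ω X Z →
    ∀ (I : Set ℝ) (Γ : ℝ → EuclideanSpace ℝ (Fin n)),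
      I.OrdConnected → Set.MapsTo Γ I Ω → IsIntegralCurveOn Γ (fun _ => Z) I →
      (∃ t₀ ∈ I, IsMaxOn w Ω (Γ t₀) ∧ 0 ≤ w (Γ t₀)) →
      ∀ t ∈ I, IsMaxOn w Ω (Γ t)

/-! The argument follows Bony's treatment of the strong maximum principle. Let `F` be the set of
points of `Ω` where `φ - ψ` attains a nonnegative maximum; it is closed relative to `Ω`. A field is
called tangent to `F` if it is orthogonal to `y - x` whenever `x` is a point of `F` nearest to `y`.
Two facts hold for smooth fields. Integral curves of a tangent field that meet `F` stay in `F`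
(`IsTangentTo.mem_of_isIntegralCurveOn`), because the squared distance to `F` satisfies a Gronwall
inequality. Tangent fields are closed under brackets (`IsTangentTo.lieBracket`), because the
commutator of the flows preserves `F` and moves a point by `s² [V, W]` to leading order. Closure
under sums and multiplication by functions is pointwise, so it is enough to show that each `X k` is
tangent.

This is where the differential inequality enters. Suppose `h` vanishes at `x₀ ∈ F` and is negative
at the other points of `F` near `x₀`. Then `φ - ψ + ε h` has local maxima tending to `x₀` as `ε →
0`. Comparing the operators there, dividing by `ε` and passing to the limit bounds the second order
part of `h` at `x₀` by a constant times its gradient (`exists_secondOrderPart_le`). The constant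
does not depend on `h`, so `h = s + K s²` may be inserted with `K` arbitrarily large: the squares
produce `2K ∑ (X k s)²` while the gradient at `x₀` stays fixed, which forces `X k s = 0`
(`fieldDeriv_eq_zero_of_neg_on_maxima`). A suitable `s` built from squared distances turns this into
tangency (`isTangentTo_of_isSumOfSquares`).

In the constant rank case the frozen matrix is factored smoothly as `B Bᵀ` (`exists_smooth_factor`).
The kernel projection `P` is a polynomial in the matrix `A` with smooth coefficients, `A + P` is
positive definite and has a smooth Cholesky factor `L`, and `B = (1 - P) L`. The columns of `B` give
the fields `X k`. -/

/-! ### Tangent fields and invariance under their integral curves. -/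

section Propagation

open Set Filter Topology Metric

/-- Euclidean `n`-space. -/
abbrev Euc (n : ℕ) := EuclideanSpace ℝ (Fin n)

variable {n : ℕ} {Ω F : Set (Euc n)} {V W : Euc n → Euc n} {x₀ : Euc n}

/-- `V` is orthogonal to every exterior normal of `F`: whenever `x ∈ F` is a point of `F` nearest
to `y`, the vectors `V x` and `y - x` are orthogonal. -/
def IsTangentTo (F : Set (Euc n)) (V : Euc n → Euc n) : Prop :=
  ∀ x ∈ F, ∀ y, (∀ z ∈ F, dist x y ≤ dist z y) → inner ℝ (V x) (y - x) = 0

lemma IsTangentTo.neg (h : IsTangentTo F V) : IsTangentTo F (fun x => -V x) := by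
  intro x hx y hy
  rw [inner_neg_left, h x hx y hy, neg_zero]

lemma differentiableAt_of_contDiffOn {G : Type*} [NormedAddCommGroup G] [NormedSpace ℝ G]
    {f : Euc n → G} (hΩ : IsOpen Ω) (hf : ContDiffOn ℝ ∞ f Ω) {x : Euc n} (hx : x ∈ Ω) :
    DifferentiableAt ℝ f x :=
  (hf.contDiffAt (hΩ.mem_nhds hx)).differentiableAt (by simp)

lemma contDiffAt_one_of_contDiffOn {G : Type*} [NormedAddCommGroup G] [NormedSpace ℝ G]
    {f : Euc n → G} (hΩ : IsOpen Ω) (hf : ContDiffOn ℝ ∞ f Ω) {x : Euc n} (hx : x ∈ Ω) :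
    ContDiffAt ℝ 1 f x :=
  (hf.contDiffAt (hΩ.mem_nhds hx)).of_le (by norm_cast)

/-- Short integral curves, started in `F`, of a field tangent to `F` end in `F`. -/
lemma IsTangentTo.exists_forward_invariant (hF : IsTangentTo F V) (hx₀ : x₀ ∈ F)
    (hV : ContDiffAt ℝ 1 V x₀) {R : ℝ} (hR : 0 < R) (hc : IsClosed (F ∩ closedBall x₀ R)) :
    ∃ ρ > 0, ∀ (γ : ℝ → Euc n) (a b : ℝ), a ≤ b → ContinuousOn γ (Icc a b) →
      (∀ t ∈ Ico a b, HasDerivWithinAt γ (V (γ t)) (Ici t) t) →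
      (∀ t ∈ Icc a b, γ t ∈ ball x₀ ρ) → γ a ∈ F → γ b ∈ F := by
  obtain ⟨K, T, hT, hK⟩ := hV.exists_lipschitzOnWith
  obtain ⟨δ, hδ, hδT⟩ := Metric.mem_nhds_iff.mp hT
  -- The factor 2 makes truncation harmless: a point within `ρ` of `x₀` is closer to `x₀` than to
  -- anything outside the ball of radius `2 * ρ`, so its nearest point in `S` is also nearest in all
  -- of `F`.
  obtain ⟨ρ, hρ, hρR, hρδ⟩ : ∃ ρ > 0, 2 * ρ ≤ R ∧ 2 * ρ < δ := by
    refine ⟨min (R / 4) (δ / 4), by positivity, ?_, ?_⟩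
    · linarith [min_le_left (R / 4) (δ / 4)]
    · linarith [min_le_right (R / 4) (δ / 4)]
  refine ⟨ρ, hρ, fun γ a b hab hγ hγ' hball ha => ?_⟩
  set S := F ∩ closedBall x₀ (2 * ρ) with hS
  have hSc : IsCompact S := by
    have : S = (F ∩ closedBall x₀ R) ∩ closedBall x₀ (2 * ρ) := by
      rw [hS, inter_assoc, inter_eq_right.mpr (closedBall_subset_closedBall hρR)]
    rw [this]
    exact (isCompact_closedBall _ _).inter_left hc
  have hSne : S.Nonempty := ⟨x₀, hx₀, mem_closedBall_self (by positivity)⟩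
  have hST : S ⊆ T := fun x hx => hδT (lt_of_le_of_lt (mem_closedBall.mp hx.2) hρδ)
  set f : ℝ → ℝ := fun t => infDist (γ t) S ^ 2 with hf
  have hnear : ∀ t ∈ Icc a b, ∃ y ∈ S, infDist (γ t) S = dist (γ t) y ∧
      inner ℝ (V y) (γ t - y) = 0 := by
    intro t ht
    obtain ⟨y, hy, hyd⟩ := hSc.exists_infDist_eq_dist hSne (γ t)
    refine ⟨y, hy, hyd, hF y hy.1 _ fun z hz => ?_⟩
    rw [dist_comm y, dist_comm z, ← hyd]
    by_cases hzS : z ∈ closedBall x₀ (2 * ρ)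
    · exact infDist_le_dist_of_mem ⟨hz, hzS⟩
    · have h1 : infDist (γ t) S ≤ dist (γ t) x₀ :=
        infDist_le_dist_of_mem ⟨hx₀, mem_closedBall_self (by positivity)⟩
      have h2 := mem_ball.mp (hball t ht)
      have h3 : 2 * ρ < dist z x₀ := not_le.mp hzS
      have h4 := dist_triangle_left z x₀ (γ t)
      linarith
  have key : ∀ t ∈ Icc a b, f t ≤ gronwallBound 0 (2 * K) 0 (t - a) := by
    -- The squared distance need not be differentiable. Freezing the nearest point `y` at time `t`
    -- gives a differentiable majorant that agrees with `f` at `t`, which is enough for the lower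
    -- right derivative.
    refine le_gronwallBound_of_liminf_deriv_right_le (f' := fun t => 2 * K * f t) ?_ ?_ ?_ ?_
    · exact ((continuous_infDist_pt S).comp_continuousOn hγ).pow 2
    · intro t ht r hr
      obtain ⟨y, hy, hyd, hy0⟩ := hnear t (Ico_subset_Icc_self ht)
      have hq : HasDerivWithinAt (fun z => ‖γ z - y‖ ^ 2)
          (2 * inner ℝ (γ t - y) (V (γ t))) (Ici t) t := ((hγ' t ht).sub_const y).norm_sq
      have hle : 2 * inner ℝ (γ t - y) (V (γ t)) ≤ 2 * K * f t := by
        -- Tangency at `y` allows `V y` to be subtracted for free, after which the Lipschitz bound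
        -- applies.
        have h1 : inner ℝ (γ t - y) (V (γ t)) = inner ℝ (γ t - y) (V (γ t) - V y) := by
          rw [inner_sub_right, real_inner_comm, real_inner_comm (V y), hy0, sub_zero]
        have hγT : γ t ∈ T := hδT (by
          have := mem_ball.mp (hball t (Ico_subset_Icc_self ht))
          exact mem_ball.mpr (by linarith))
        have h2 := hK.dist_le_mul _ hγT _ (hST hy)
        rw [dist_eq_norm, dist_eq_norm] at h2
        have h3 := real_inner_le_norm (γ t - y) (V (γ t) - V y)
        have h4 : f t = ‖γ t - y‖ ^ 2 := by rw [hf]; simp only; rw [hyd, dist_eq_norm]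
        rw [h1, h4]
        nlinarith [norm_nonneg (γ t - y)]
      have hs := (hasDerivWithinAt_iff_tendsto_slope' (self_notMem_Ioi)).mp
        hq.Ioi_of_Ici
      have hev := hs.eventually_lt_const (hle.trans_lt hr)
      refine Eventually.frequently ?_
      filter_upwards [hev, self_mem_nhdsWithin] with z hz hzt
      refine lt_of_le_of_lt ?_ hz
      rw [slope_def_module, smul_eq_mul]
      have hz0 : 0 ≤ (z - t)⁻¹ := inv_nonneg.mpr (sub_nonneg.mpr (le_of_lt hzt))
      refine mul_le_mul_of_nonneg_left ?_ hz0
      have h5 : infDist (γ z) S ≤ ‖γ z - y‖ := by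
        rw [← dist_eq_norm]; exact infDist_le_dist_of_mem hy
      have h6 : f t = ‖γ t - y‖ ^ 2 := by rw [hf]; simp only; rw [hyd, dist_eq_norm]
      have h7 : f z ≤ ‖γ z - y‖ ^ 2 := pow_le_pow_left₀ infDist_nonneg h5 2
      rw [h6]
      linarith
    · have : γ a ∈ S := ⟨ha, by
        have := mem_ball.mp (hball a (left_mem_Icc.mpr hab))
        exact mem_closedBall.mpr (by linarith)⟩
      simp [hf, infDist_zero_of_mem this]
    · intro t _
      simp
  have hb := key b (right_mem_Icc.mpr hab)
  rw [gronwallBound_ε0_δ0] at hb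
  have hb0 : infDist (γ b) S = 0 := by
    have : infDist (γ b) S ^ 2 = 0 := le_antisymm hb (sq_nonneg _)
    exact pow_eq_zero_iff (two_ne_zero) |>.mp this
  exact ((hSc.isClosed.mem_iff_infDist_zero hSne).mpr hb0).1

/-- Integral curves in `Ω` of a field tangent to a relatively closed set `F ⊆ Ω` that meet `F`
stay in `F`. -/
lemma IsTangentTo.mem_of_isIntegralCurveOn (hΩ : IsOpen Ω)
    (hFc : ∀ x ∈ Ω, x ∈ closure F → x ∈ F) (hV : ContDiffOn ℝ ∞ V Ω) (hF : IsTangentTo F V)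
    {I : Set ℝ} {γ : ℝ → Euc n} (hI : I.OrdConnected) (hγΩ : MapsTo γ I Ω)
    (hγ : IsIntegralCurveOn γ (fun _ => V) I) {t₀ : ℝ} (ht₀ : t₀ ∈ I) (h₀ : γ t₀ ∈ F) :
    ∀ t ∈ I, γ t ∈ F := by
  have hcont : ContinuousOn γ I := fun t ht => (hγ t ht).continuousWithinAt
  have hclosed : ∀ x ∈ Ω, ∃ R > 0, IsClosed (F ∩ closedBall x R) := by
    intro x hx
    obtain ⟨R, hR, hRΩ⟩ := nhds_basis_closedBall.mem_iff.mp (hΩ.mem_nhds hx)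
    refine ⟨R, hR, isClosed_of_closure_subset fun z hz => ?_⟩
    have h1 : z ∈ closedBall x R :=
      isClosed_closedBall.closure_subset (closure_mono inter_subset_right hz)
    exact ⟨hFc z (hRΩ h1) (closure_mono inter_subset_left hz), h1⟩
  have hopen : ∀ s ∈ I, γ s ∈ F → ∀ᶠ t in 𝓝[I] s, γ t ∈ F := by
    intro s hs hsF
    obtain ⟨R, hR, hc⟩ := hclosed _ (hγΩ hs)
    have hV1 := contDiffAt_one_of_contDiffOn hΩ hV (hγΩ hs)
    obtain ⟨ρ, hρ, H⟩ := hF.exists_forward_invariant hsF hV1 hR hc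
    -- Backward times are forward times for `-V` along the reversed curve.
    obtain ⟨ρ', hρ', H'⟩ := hF.neg.exists_forward_invariant hsF hV1.neg hR hc
    have hb : ∀ᶠ t in 𝓝[I] s, γ t ∈ ball (γ s) (min ρ ρ') :=
      hcont s hs (ball_mem_nhds _ (lt_min hρ hρ'))
    obtain ⟨δ, hδ, hδb⟩ := Metric.mem_nhdsWithin_iff.mp hb
    filter_upwards [inter_mem_nhdsWithin I (ball_mem_nhds s hδ)] with t ht
    have hsub : ∀ u ∈ uIcc s t, u ∈ I ∧ γ u ∈ ball (γ s) (min ρ ρ') := by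
      intro u hu
      have huI := hI.uIcc_subset hs ht.1 hu
      refine ⟨huI, hδb ⟨?_, huI⟩⟩
      have := abs_sub_left_of_mem_uIcc hu
      rw [mem_ball, Real.dist_eq]
      exact lt_of_le_of_lt this (by simpa [Real.dist_eq] using ht.2)
    rcases le_total s t with hst | hts
    · rw [uIcc_of_le hst] at hsub
      refine H γ s t hst (hcont.mono fun u hu => (hsub u hu).1) (fun u hu => ?_)
        (fun u hu => ball_subset_ball (min_le_left _ _) (hsub u hu).2) hsF
      have h1 := (hγ u (hsub u (Ico_subset_Icc_self hu)).1).mono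
        (fun v hv => (hsub v hv).1 : Icc s t ⊆ I)
      exact h1.mono_of_mem_nhdsWithin (Icc_mem_nhdsGE_of_mem hu)
    · rw [uIcc_of_ge hts] at hsub
      have hm : ∀ u ∈ Icc (-s) (-t), -u ∈ Icc t s := fun u hu =>
        ⟨by linarith [hu.2], by linarith [hu.1]⟩
      have := H' (fun u => γ (-u)) (-s) (-t) (by linarith)
        (hcont.comp continuous_neg.continuousOn fun u hu => (hsub _ (hm u hu)).1)
        (fun u hu => ?_)
        (fun u hu => ball_subset_ball (min_le_right _ _) (hsub _ (hm u hu)).2) (by simpa using hsF)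
      · simpa using this
      have h1 := (hγ (-u) (hsub _ (hm u (Ico_subset_Icc_self hu))).1).mono
        (fun v hv => (hsub v hv).1 : Icc t s ⊆ I)
      have h2 := h1.scomp u (hasDerivWithinAt_neg u (Icc (-s) (-t))) hm
      rw [neg_one_smul] at h2
      exact h2.mono_of_mem_nhdsWithin (Icc_mem_nhdsGE_of_mem hu)
  have hpre : IsPreconnected I := hI.isPreconnected
  intro t ht
  by_contra hcon
  have hopen' : ∀ s ∈ I, γ s ∉ F → ∀ᶠ t in 𝓝[I] s, γ t ∉ F := by
    intro s hs hsF
    have : γ s ∈ (closure F)ᶜ := fun h => hsF (hFc _ (hγΩ hs) h)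
    filter_upwards [hcont s hs (isClosed_closure.isOpen_compl.mem_nhds this)] with u hu huF
    exact hu (subset_closure huF)
  -- Membership of `γ` in `F` is locally constant on `I`, hence constant on the interval.
  have hloc : ∀ s ∈ I, ∀ᶠ u in 𝓝[I] s, (γ s ∈ F ↔ γ u ∈ F) := by
    intro s hs
    by_cases h : γ s ∈ F
    · filter_upwards [hopen s hs h] with u hu
      simp [h, hu]
    · filter_upwards [hopen' s hs h] with u hu
      simp [h, hu]
  exact hcon ((hpre.induction₂ (fun s u => (γ s ∈ F ↔ γ u ∈ F)) hloc
    (fun x y z _ _ _ h1 h2 => h1.trans h2) (fun x y _ _ h => h.symm) ht₀ ht).mp h₀)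

end Propagation

/-! ### Local flows, Taylor expansions along them, and Lie brackets. -/

section Commutator

open Set Filter Topology Metric Asymptotics

variable {n : ℕ} {Ω F : Set (Euc n)} {V W : Euc n → Euc n} {x₀ : Euc n}

lemma contDiffOn_fieldDeriv (hΩ : IsOpen Ω) (hV : ContDiffOn ℝ ∞ V Ω) {f : Euc n → ℝ}
    (hf : ContDiffOn ℝ ∞ f Ω) : ContDiffOn ℝ ∞ (fieldDeriv V f) Ω :=
  (hf.fderiv_of_isOpen hΩ (by simp)).clm_apply hV

lemma contDiffOn_lieBracket (hΩ : IsOpen Ω) (hV : ContDiffOn ℝ ∞ V Ω)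
    (hW : ContDiffOn ℝ ∞ W Ω) : ContDiffOn ℝ ∞ (VectorField.lieBracket ℝ V W) Ω :=
  ((hW.fderiv_of_isOpen hΩ (by simp)).clm_apply hV).sub
    ((hV.fderiv_of_isOpen hΩ (by simp)).clm_apply hW)

/-- A local flow of `V` around `x₀` that stays in a closed ball contained in `Ω`. -/
structure LocalFlow (Ω : Set (Euc n)) (V : Euc n → Euc n) (x₀ : Euc n) where
  /-- the flow map -/
  map : Euc n → ℝ → Euc n
  /-- radius of the set of starting points -/
  r : ℝ
  /-- existence time -/
  ε : ℝ
  /-- radius of a ball containing the flow lines -/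
  ρ : ℝ
  r_pos : 0 < r
  ε_pos : 0 < ε
  closedBall_subset : closedBall x₀ ρ ⊆ Ω
  map_zero : ∀ x ∈ ball x₀ r, map x 0 = x
  hasDerivAt : ∀ x ∈ ball x₀ r, ∀ t, |t| < ε → HasDerivAt (map x) (V (map x t)) t
  mem_closedBall : ∀ x ∈ ball x₀ r, ∀ t, |t| < ε → map x t ∈ closedBall x₀ ρ
  tendsto : Tendsto (fun q : Euc n × ℝ => map q.1 q.2) (𝓝 (x₀, 0)) (𝓝 x₀)

lemma nonempty_localFlow (hΩ : IsOpen Ω) (hV : ContDiffOn ℝ ∞ V Ω) (hx₀ : x₀ ∈ Ω) :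
    Nonempty (LocalFlow Ω V x₀) := by
  obtain ⟨ε, hε, a, r, L, K, hr, hpl⟩ :=
    IsPicardLindelof.of_contDiffAt_one (contDiffAt_one_of_contDiffOn hΩ hV hx₀)
  obtain ⟨α, hα, hαc⟩ := (hpl 0).exists_forall_mem_closedBall_eq_hasDerivWithinAt_continuousOn
  simp only [zero_sub, zero_add] at hα hαc
  obtain ⟨ρ, hρ, hρΩ⟩ := nhds_basis_closedBall.mem_iff.mp (hΩ.mem_nhds hx₀)
  have hr' : (0 : ℝ) < r := hr
  have hca : ContinuousAt α (x₀, 0) := hαc.continuousAt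
    (prod_mem_nhds (closedBall_mem_nhds x₀ hr') (Icc_mem_nhds (by linarith) hε))
  have hα0 : α (x₀, 0) = x₀ := (hα x₀ (mem_closedBall_self hr'.le)).1
  have ht : Tendsto α (𝓝 (x₀, 0)) (𝓝 x₀) := by
    have := hca.tendsto
    rwa [hα0] at this
  obtain ⟨δ, hδ, hδb⟩ := Metric.mem_nhds_iff.mp (ht (closedBall_mem_nhds x₀ hρ))
  have hsub : ∀ x ∈ ball x₀ (min δ r), ∀ t, |t| < min δ ε →
      α (x, t) ∈ closedBall x₀ ρ := fun x hx t ht => hδb (by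
    rw [mem_ball, Prod.dist_eq]
    refine max_lt (lt_of_lt_of_le hx (min_le_left _ _)) ?_
    simpa [Real.dist_eq] using lt_of_lt_of_le ht (min_le_left _ _))
  have hbr : ball x₀ (min δ r) ⊆ closedBall x₀ r :=
    (ball_subset_ball (min_le_right _ _)).trans ball_subset_closedBall
  exact ⟨{
    map := fun x t => α (x, t)
    r := min δ r
    ε := min δ ε
    ρ := ρ
    r_pos := lt_min hδ hr'
    ε_pos := lt_min hδ hε
    closedBall_subset := hρΩ
    map_zero := fun x hx => (hα x (hbr hx)).1
    hasDerivAt := fun x hx t ht => by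
      have h := abs_lt.mp (lt_of_lt_of_le ht (min_le_right _ _))
      exact ((hα x (hbr hx)).2 t ⟨h.1.le, h.2.le⟩).hasDerivAt (Icc_mem_nhds h.1 h.2)
    mem_closedBall := hsub
    tendsto := ht }⟩

/-- Mean value inequality on the segment from 0 to `t`. Only the order in `t` matters later, so the
sharper constant `C / (k + 1)` is not sought. -/
lemma abs_sub_le_of_abs_deriv_le_pow {u u' : ℝ → ℝ} {ε C : ℝ} {k : ℕ} (hC : 0 ≤ C)
    (hu : ∀ t, |t| < ε → HasDerivAt u (u' t) t) (hb : ∀ t, |t| < ε → |u' t| ≤ C * |t| ^ k)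
    {t : ℝ} (ht : |t| < ε) : |u t - u 0| ≤ C * |t| ^ (k + 1) := by
  have hle : ∀ s ∈ uIcc 0 t, |s| ≤ |t| := fun s hs => by
    simpa using abs_sub_left_of_mem_uIcc hs
  have := (convex_uIcc (0 : ℝ) t).norm_image_sub_le_of_norm_hasDerivWithin_le
    (f := u) (f' := u') (C := C * |t| ^ k)
    (fun s hs => (hu s ((hle s hs).trans_lt ht)).hasDerivWithinAt)
    (fun s hs => (hb s ((hle s hs).trans_lt ht)).trans
      (mul_le_mul_of_nonneg_left (pow_le_pow_left₀ (abs_nonneg _) (hle s hs) k) hC))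
    left_mem_uIcc right_mem_uIcc
  simpa [pow_succ, mul_assoc] using this

namespace LocalFlow

variable {g : Euc n → ℝ}

lemma hasDerivAt_comp (Φ : LocalFlow Ω V x₀) (hΩ : IsOpen Ω) (hg : ContDiffOn ℝ ∞ g Ω)
    {x : Euc n} (hx : x ∈ ball x₀ Φ.r) {t : ℝ} (ht : |t| < Φ.ε) :
    HasDerivAt (fun t => g (Φ.map x t)) (fieldDeriv V g (Φ.map x t)) t :=
  (differentiableAt_of_contDiffOn hΩ hg
    (Φ.closedBall_subset (Φ.mem_closedBall x hx t ht))).hasFDerivAt.comp_hasDerivAt t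
      (Φ.hasDerivAt x hx t ht)

/-- The flow lines stay in one compact ball, so `C` is uniform in the starting point. This is needed
because the later legs of the commutator start at points moving with `s`. Higher orders follow by
applying the previous order to `fieldDeriv V g`. -/
lemma exists_taylor_one (Φ : LocalFlow Ω V x₀) (hΩ : IsOpen Ω) (hV : ContDiffOn ℝ ∞ V Ω)
    (hg : ContDiffOn ℝ ∞ g Ω) : ∃ C ≥ 0, ∀ x ∈ ball x₀ Φ.r, ∀ t, |t| < Φ.ε →
      |g (Φ.map x t) - g x| ≤ C * |t| ^ 1 := by
  obtain ⟨C, hC⟩ := (isCompact_closedBall x₀ Φ.ρ).exists_bound_of_continuousOn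
    ((contDiffOn_fieldDeriv hΩ hV hg).continuousOn.mono Φ.closedBall_subset)
  refine ⟨max C 0, le_max_right _ _, fun x hx t ht => ?_⟩
  have := abs_sub_le_of_abs_deriv_le_pow (k := 0) (le_max_right C 0)
    (fun s hs => Φ.hasDerivAt_comp hΩ hg hx hs) (fun s hs => by
      simpa using Or.inl (hC _ (Φ.mem_closedBall x hx s hs))) ht
  rwa [Φ.map_zero x hx] at this

lemma exists_taylor_two (Φ : LocalFlow Ω V x₀) (hΩ : IsOpen Ω) (hV : ContDiffOn ℝ ∞ V Ω)
    (hg : ContDiffOn ℝ ∞ g Ω) : ∃ C ≥ 0, ∀ x ∈ ball x₀ Φ.r, ∀ t, |t| < Φ.ε →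
      |g (Φ.map x t) - g x - t * fieldDeriv V g x| ≤ C * |t| ^ 2 := by
  obtain ⟨C, hC, h⟩ := Φ.exists_taylor_one hΩ hV (contDiffOn_fieldDeriv hΩ hV hg)
  refine ⟨C, hC, fun x hx t ht => ?_⟩
  have := abs_sub_le_of_abs_deriv_le_pow (k := 1) hC
    (fun s hs => (Φ.hasDerivAt_comp hΩ hg hx hs).sub
      ((hasDerivAt_id s).mul_const (fieldDeriv V g x)))
    (fun s hs => by simpa using h x hx s hs) ht
  simp only [Pi.sub_apply, id, Φ.map_zero x hx] at this
  convert this using 2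
  ring

lemma exists_taylor_three (Φ : LocalFlow Ω V x₀) (hΩ : IsOpen Ω) (hV : ContDiffOn ℝ ∞ V Ω)
    (hg : ContDiffOn ℝ ∞ g Ω) : ∃ C ≥ 0, ∀ x ∈ ball x₀ Φ.r, ∀ t, |t| < Φ.ε →
      |g (Φ.map x t) - g x - t * fieldDeriv V g x
        - t ^ 2 / 2 * fieldDeriv V (fieldDeriv V g) x| ≤ C * |t| ^ 3 := by
  obtain ⟨C, hC, h⟩ := Φ.exists_taylor_two hΩ hV (contDiffOn_fieldDeriv hΩ hV hg)
  refine ⟨C, hC, fun x hx t ht => ?_⟩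
  have := abs_sub_le_of_abs_deriv_le_pow (k := 2) hC
    (fun s hs => ((Φ.hasDerivAt_comp hΩ hg hx hs).sub
      ((hasDerivAt_id s).mul_const (fieldDeriv V g x))).sub
      (((hasDerivAt_pow 2 s).div_const 2).mul_const (fieldDeriv V (fieldDeriv V g) x)))
    (fun s hs => by
      convert h x hx s hs using 2
      simp) ht
  simp only [Pi.sub_apply, id, Φ.map_zero x hx] at this
  convert this using 2
  ring

variable {l : Filter ℝ} {p : ℝ → Euc n} {σ : ℝ}

lemma tendsto_comp (Φ : LocalFlow Ω V x₀) (hl : l ≤ 𝓝 0) (hp : Tendsto p l (𝓝 x₀)) (σ : ℝ) :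
    Tendsto (fun s => Φ.map (p s) (σ * s)) l (𝓝 x₀) := by
  have h0 : Tendsto (fun s : ℝ => σ * s) l (𝓝 0) := by
    have : Tendsto (fun s : ℝ => σ * s) (𝓝 0) (𝓝 (σ * 0)) := tendsto_id.const_mul σ
    rw [mul_zero] at this
    exact this.mono_left hl
  exact Φ.tendsto.comp (hp.prodMk_nhds h0)

lemma eventually_mem (Φ : LocalFlow Ω V x₀) (hl : l ≤ 𝓝 0) (hp : Tendsto p l (𝓝 x₀)) (σ : ℝ) :
    ∀ᶠ s in l, p s ∈ ball x₀ Φ.r ∧ |σ * s| < Φ.ε := by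
  have h0 : Tendsto (fun s : ℝ => |σ * s|) l (𝓝 0) := by
    have : Tendsto (fun s : ℝ => |σ * s|) (𝓝 0) (𝓝 |σ * 0|) := (tendsto_id.const_mul σ).abs
    rw [mul_zero, abs_zero] at this
    exact this.mono_left hl
  exact (hp.eventually (ball_mem_nhds _ Φ.r_pos)).and (h0.eventually_lt_const Φ.ε_pos)

lemma isBigO_of_bound (Φ : LocalFlow Ω V x₀) (hl : l ≤ 𝓝 0) (hp : Tendsto p l (𝓝 x₀))
    {f : Euc n → ℝ → ℝ} {k : ℕ}
    (hf : ∃ C ≥ 0, ∀ x ∈ ball x₀ Φ.r, ∀ t, |t| < Φ.ε → |f x t| ≤ C * |t| ^ k) (σ : ℝ) :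
    (fun s => f (p s) (σ * s)) =O[l] fun s : ℝ => s ^ k := by
  obtain ⟨C, -, hC⟩ := hf
  refine IsBigO.of_bound (C * |σ| ^ k) ?_
  filter_upwards [Φ.eventually_mem hl hp σ] with s hs
  have := hC _ hs.1 _ hs.2
  simpa [abs_mul, mul_pow, mul_assoc] using this

end LocalFlow

lemma isBigO_const_mul_pow_mul {l : Filter ℝ} {f : ℝ → ℝ} {k : ℕ}
    (hf : f =O[l] fun s : ℝ => s ^ k) (c : ℝ) (j : ℕ) :
    (fun s => c * s ^ j * f s) =O[l] fun s : ℝ => s ^ (j + k) := by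
  have := ((isBigO_refl (fun s : ℝ => s ^ j) l).const_mul_left c).mul hf
  simpa [pow_add] using this

/-- Composing the flows of `V`, `W`, `-V`, `-W` for a short time `s` changes a function `h` by
`s² [V, W] h` up to third order. -/
lemma commutator_isBigO (hΩ : IsOpen Ω) (hV : ContDiffOn ℝ ∞ V Ω) (hW : ContDiffOn ℝ ∞ W Ω)
    (Φ : LocalFlow Ω V x₀) (Ψ : LocalFlow Ω W x₀) {h : Euc n → ℝ} (hh : ContDiffOn ℝ ∞ h Ω)
    {l : Filter ℝ} (hl : l ≤ 𝓝 0) {x₁ x₂ x₃ x₄ : ℝ → Euc n}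
    (h₁ : x₁ = fun s => Φ.map x₀ (1 * s)) (h₂ : x₂ = fun s => Ψ.map (x₁ s) (1 * s))
    (h₃ : x₃ = fun s => Φ.map (x₂ s) ((-1) * s)) (h₄ : x₄ = fun s => Ψ.map (x₃ s) ((-1) * s)) :
    (fun s => h (x₄ s) - h x₀
      - s ^ 2 * (fieldDeriv V (fieldDeriv W h) x₀ - fieldDeriv W (fieldDeriv V h) x₀))
      =O[l] fun s : ℝ => s ^ 3 := by
  have t₀ : Tendsto (fun _ : ℝ => x₀) l (𝓝 x₀) := tendsto_const_nhds
  have t₁ : Tendsto x₁ l (𝓝 x₀) := h₁ ▸ Φ.tendsto_comp hl t₀ 1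
  have t₂ : Tendsto x₂ l (𝓝 x₀) := h₂ ▸ Ψ.tendsto_comp hl t₁ 1
  have t₃ : Tendsto x₃ l (𝓝 x₀) := h₃ ▸ Φ.tendsto_comp hl t₂ (-1)
  have hVh := contDiffOn_fieldDeriv hΩ hV hh
  have hWh := contDiffOn_fieldDeriv hΩ hW hh
  have hVV := contDiffOn_fieldDeriv hΩ hV hVh
  have hWW := contDiffOn_fieldDeriv hΩ hW hWh
  have hVW := contDiffOn_fieldDeriv hΩ hV hWh
  have hWV := contDiffOn_fieldDeriv hΩ hW hVh
  -- The expansion is unwound from the last leg: `T1` expands at `x₃`, `T2`–`T4` transport every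
  -- term to `x₂`, `T5`–`T10` to `x₁`, `T11`–`T15` to `x₀`. A term already carrying `s ^ j` needs
  -- only order `3 - j`. The pure `VV` and `WW` terms cancel.
  have T1 := Ψ.isBigO_of_bound hl t₃ (Ψ.exists_taylor_three hΩ hW hh) (-1)
  have T2 := Φ.isBigO_of_bound hl t₂ (Φ.exists_taylor_three hΩ hV hh) (-1)
  have T3 := isBigO_const_mul_pow_mul
    (Φ.isBigO_of_bound hl t₂ (Φ.exists_taylor_two hΩ hV hWh) (-1)) (-1) 1
  have T4 := isBigO_const_mul_pow_mul
    (Φ.isBigO_of_bound hl t₂ (Φ.exists_taylor_one hΩ hV hWW) (-1)) (1 / 2) 2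
  have T5 := Ψ.isBigO_of_bound hl t₁ (Ψ.exists_taylor_three hΩ hW hh) 1
  have T6 := isBigO_const_mul_pow_mul
    (Ψ.isBigO_of_bound hl t₁ (Ψ.exists_taylor_two hΩ hW hVh) 1) (-1) 1
  have T7 := isBigO_const_mul_pow_mul
    (Ψ.isBigO_of_bound hl t₁ (Ψ.exists_taylor_one hΩ hW hVV) 1) (1 / 2) 2
  have T8 := isBigO_const_mul_pow_mul
    (Ψ.isBigO_of_bound hl t₁ (Ψ.exists_taylor_two hΩ hW hWh) 1) (-1) 1
  have T9 := isBigO_const_mul_pow_mul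
    (Ψ.isBigO_of_bound hl t₁ (Ψ.exists_taylor_one hΩ hW hVW) 1) 1 2
  have T10 := isBigO_const_mul_pow_mul
    (Ψ.isBigO_of_bound hl t₁ (Ψ.exists_taylor_one hΩ hW hWW) 1) (1 / 2) 2
  have T11 := Φ.isBigO_of_bound hl t₀ (Φ.exists_taylor_three hΩ hV hh) 1
  have T12 := isBigO_const_mul_pow_mul
    (Φ.isBigO_of_bound hl t₀ (Φ.exists_taylor_two hΩ hV hVh) 1) (-1) 1
  have T13 := isBigO_const_mul_pow_mul
    (Φ.isBigO_of_bound hl t₀ (Φ.exists_taylor_one hΩ hV hVV) 1) (1 / 2) 2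
  have T14 := isBigO_const_mul_pow_mul
    (Φ.isBigO_of_bound hl t₀ (Φ.exists_taylor_one hΩ hV hWV) 1) (-1) 2
  have T15 := isBigO_const_mul_pow_mul
    (Φ.isBigO_of_bound hl t₀ (Φ.exists_taylor_one hΩ hV hVW) 1) 1 2
  have S := ((((((((((((((T1.add T2).add T3).add T4).add T5).add T6).add T7).add T8).add T9).add
    T10).add T11).add T12).add T13).add T14).add T15)
  refine S.congr_left fun s => ?_
  simp only [← congrFun h₁ s, ← congrFun h₂ s, ← congrFun h₃ s, ← congrFun h₄ s]
  ring

/-- If `F` is invariant under the flows of `V` and `W` and `h` has a minimum over `F` at `x₀ ∈ F`,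
then `[V, W] h ≥ 0` at `x₀`. -/
lemma commutator_nonneg (hΩ : IsOpen Ω)
    (hFc : ∀ x ∈ Ω, x ∈ closure F → x ∈ F) (hV : ContDiffOn ℝ ∞ V Ω) (hW : ContDiffOn ℝ ∞ W Ω)
    (hFV : IsTangentTo F V) (hFW : IsTangentTo F W) (hx₀ : x₀ ∈ F) (hx₀Ω : x₀ ∈ Ω)
    {h : Euc n → ℝ} (hh : ContDiffOn ℝ ∞ h Ω) (hmin : ∀ z ∈ F, h x₀ ≤ h z) :
    0 ≤ fieldDeriv V (fieldDeriv W h) x₀ - fieldDeriv W (fieldDeriv V h) x₀ := by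
  obtain ⟨Φ⟩ := nonempty_localFlow hΩ hV hx₀Ω
  obtain ⟨Ψ⟩ := nonempty_localFlow hΩ hW hx₀Ω
  have inv : ∀ {Z : Euc n → Euc n}, ContDiffOn ℝ ∞ Z Ω → IsTangentTo F Z →
      ∀ (Θ : LocalFlow Ω Z x₀) (x : Euc n) (t : ℝ), x ∈ ball x₀ Θ.r ∧ |t| < Θ.ε → x ∈ F →
        Θ.map x t ∈ F := by
    intro Z hZ hFZ Θ x t hxt hxF
    refine hFZ.mem_of_isIntegralCurveOn hΩ hFc hZ (I := Ioo (-Θ.ε) Θ.ε) (t₀ := 0)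
      ordConnected_Ioo (fun s hs => Θ.closedBall_subset (Θ.mem_closedBall x hxt.1 s (abs_lt.mpr hs)))
      (fun s hs => (Θ.hasDerivAt x hxt.1 s (abs_lt.mpr hs)).hasDerivWithinAt)
      ⟨neg_lt_zero.mpr Θ.ε_pos, Θ.ε_pos⟩ ?_ t (abs_lt.mp hxt.2)
    rwa [Θ.map_zero x hxt.1]
  set l : Filter ℝ := 𝓝[>] 0
  have hl : l ≤ 𝓝 0 := nhdsWithin_le_nhds
  set x₁ := fun s : ℝ => Φ.map x₀ (1 * s) with h₁
  set x₂ := fun s : ℝ => Ψ.map (x₁ s) (1 * s) with h₂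
  set x₃ := fun s : ℝ => Φ.map (x₂ s) ((-1) * s) with h₃
  set x₄ := fun s : ℝ => Ψ.map (x₃ s) ((-1) * s) with h₄
  have t₀ : Tendsto (fun _ : ℝ => x₀) l (𝓝 x₀) := tendsto_const_nhds
  have t₁ : Tendsto x₁ l (𝓝 x₀) := Φ.tendsto_comp hl t₀ 1
  have t₂ : Tendsto x₂ l (𝓝 x₀) := Ψ.tendsto_comp hl t₁ 1
  have t₃ : Tendsto x₃ l (𝓝 x₀) := Φ.tendsto_comp hl t₂ (-1)
  obtain ⟨C, hC⟩ := (commutator_isBigO hΩ hV hW Φ Ψ hh hl h₁ h₂ h₃ h₄).bound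
  set c := fieldDeriv V (fieldDeriv W h) x₀ - fieldDeriv W (fieldDeriv V h) x₀
  have hev : ∀ᶠ s in l, -(C * s) ≤ c := by
    filter_upwards [hC, Φ.eventually_mem hl t₀ 1, Ψ.eventually_mem hl t₁ 1,
      Φ.eventually_mem hl t₂ (-1), Ψ.eventually_mem hl t₃ (-1), self_mem_nhdsWithin]
      with s hs e₁ e₂ e₃ e₄ hs0
    have hs0 : 0 < s := hs0
    have hm := hmin _ (inv hW hFW Ψ _ _ e₄ (inv hV hFV Φ _ _ e₃
      (inv hW hFW Ψ _ _ e₂ (inv hV hFV Φ _ _ e₁ hx₀))))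
    rw [Real.norm_eq_abs, Real.norm_eq_abs, abs_of_pos (pow_pos hs0 3)] at hs
    have h5 := (abs_le.mp hs).2
    -- The four legs stay in `F`, so `h` has not decreased; dividing by `s ^ 2` and letting `s` tend
    -- to 0 from the right leaves `0 ≤ c`.
    have h6 : 0 ≤ s ^ 2 * (c + C * s) := by
      have : h x₀ ≤ h (x₄ s) := hm
      nlinarith
    have := nonneg_of_mul_nonneg_right h6 (pow_pos hs0 2)
    linarith
  have hlim : Tendsto (fun s : ℝ => -(C * s)) l (𝓝 0) := by
    have : Tendsto (fun s : ℝ => -(C * s)) (𝓝 0) (𝓝 (-(C * 0))) := (tendsto_id.const_mul C).neg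
    rw [mul_zero, neg_zero] at this
    exact this.mono_left hl
  exact le_of_tendsto hlim hev

/-- The first term is symmetric in `V` and `W`, so antisymmetrizing leaves only the inner product of
`x₀ - y` with the bracket. -/
lemma fieldDeriv_norm_sub_sq (hΩ : IsOpen Ω) (hW : ContDiffOn ℝ ∞ W Ω)
    (hx₀ : x₀ ∈ Ω) (y : Euc n) :
    fieldDeriv V (fieldDeriv W fun x => ‖x - y‖ ^ 2) x₀
      = 2 * inner ℝ (V x₀) (W x₀) + 2 * inner ℝ (x₀ - y) (fderiv ℝ W x₀ (V x₀)) := by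
  have h1 : (fieldDeriv W fun x => ‖x - y‖ ^ 2) = fun x => 2 * inner ℝ (x - y) (W x) := by
    funext x
    have := ((hasFDerivAt_id x).sub_const y).norm_sq
    simp only [id] at this
    simp [fieldDeriv, this.fderiv, inner_sub_left]
  rw [h1]
  have h2 := (((hasFDerivAt_id x₀).sub_const y).inner ℝ
    (differentiableAt_of_contDiffOn hΩ hW hx₀).hasFDerivAt).const_mul 2
  simp only [id] at h2
  simp only [fieldDeriv, h2.fderiv]
  simp
  ring

/-- The Lie bracket of two fields tangent to `F` is tangent to `F`. -/
lemma IsTangentTo.lieBracket (hΩ : IsOpen Ω) (hFΩ : F ⊆ Ω)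
    (hFc : ∀ x ∈ Ω, x ∈ closure F → x ∈ F) (hV : ContDiffOn ℝ ∞ V Ω) (hW : ContDiffOn ℝ ∞ W Ω)
    (hFV : IsTangentTo F V) (hFW : IsTangentTo F W) :
    IsTangentTo F (VectorField.lieBracket ℝ V W) := by
  intro x hx y hy
  have hh : ContDiffOn ℝ ∞ (fun z : Euc n => ‖z - y‖ ^ 2) Ω :=
    ((contDiff_id.sub contDiff_const).norm_sq ℝ).contDiffOn
  have hmin : ∀ z ∈ F, ‖x - y‖ ^ 2 ≤ ‖z - y‖ ^ 2 := fun z hz => by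
    have := hy z hz
    rw [dist_eq_norm, dist_eq_norm] at this
    exact pow_le_pow_left₀ (norm_nonneg _) this 2
  -- The squared distance to `y` is minimal over `F` at `x`; using both orders of the fields gives
  -- opposite inequalities, hence orthogonality.
  have h1 := commutator_nonneg hΩ hFc hV hW hFV hFW hx (hFΩ hx) hh hmin
  have h2 := commutator_nonneg hΩ hFc hW hV hFW hFV hx (hFΩ hx) hh hmin
  rw [fieldDeriv_norm_sub_sq hΩ hW (hFΩ hx), fieldDeriv_norm_sub_sq hΩ hV (hFΩ hx),
    real_inner_comm] at h1 h2
  rw [VectorField.lieBracket, real_inner_comm, inner_sub_right]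
  rw [← neg_sub x y, inner_neg_left, inner_neg_left]
  rw [real_inner_comm] at h2
  linarith

end Commutator

/-! ### Second order operators at a local maximum. -/

section SecondOrder

open Set Filter Topology Metric

variable {n : ℕ} {Ω : Set (Euc n)}

/-- On the line in direction `u`, a positive second derivative would make the point a local minimum
as well; the restriction would then be locally constant, with zero second derivative. -/
lemma fderiv_fderiv_nonpos_of_isLocalMax {v : Euc n → ℝ} {x : Euc n} (hv : ContDiffAt ℝ ∞ v x)
    (hmax : IsLocalMax v x) (u : Euc n) : fderiv ℝ (fderiv ℝ v) x u u ≤ 0 := by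
  by_contra! hpos
  set q : ℝ → ℝ := fun t => v (x + t • u) with hq
  have hline : ∀ t : ℝ, HasDerivAt (fun t : ℝ => x + t • u) u t := fun t => by
    simpa using ((hasDerivAt_id t).smul_const u).const_add x
  have hline0 : Tendsto (fun t : ℝ => x + t • u) (𝓝 0) (𝓝 x) := by
    have := (hline 0).continuousAt.tendsto
    simpa using this
  have hdiff : ∀ᶠ z in 𝓝 x, DifferentiableAt ℝ v z := by
    have := (hv.of_le (by simp : (1 : WithTop ℕ∞) ≤ ∞)).eventually (by simp)
    filter_upwards [this] with z hz using hz.differentiableAt (by simp)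
  have hd : ∀ᶠ t in 𝓝 (0 : ℝ), deriv q t = fderiv ℝ v (x + t • u) u := by
    filter_upwards [hline0.eventually hdiff] with t ht
    exact (ht.hasFDerivAt.comp_hasDerivAt t (hline t)).deriv
  have h2 : DifferentiableAt ℝ (fderiv ℝ v) x :=
    (hv.fderiv_right (m := ∞) (by simp)).differentiableAt (by simp)
  have hx0 : x + (0 : ℝ) • u = x := by rw [zero_smul, add_zero]
  have hdd : deriv (deriv q) 0 = fderiv ℝ (fderiv ℝ v) x u u := by
    rw [EventuallyEq.deriv_eq hd]
    have h3 : HasFDerivAt (fun z => fderiv ℝ v z u)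
        ((fderiv ℝ (fderiv ℝ v) x).flip u) (x + (0 : ℝ) • u) := by
      rw [hx0]
      exact (h2.hasFDerivAt.clm_apply (hasFDerivAt_const u x)).congr_fderiv (by ext w; simp)
    exact (h3.comp_hasDerivAt (0 : ℝ) (hline 0)).deriv
  have hd0 : deriv q 0 = 0 := by
    rw [hd.self_of_nhds]
    simp [hmax.fderiv_eq_zero]
  have hqc : ContinuousAt q 0 := by
    have hvc : ContinuousAt v (x + (0 : ℝ) • u) := by simpa using hv.continuousAt
    exact hvc.comp (f := fun t : ℝ => x + t • u) (hline 0).continuousAt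
  have hmin := isLocalMin_of_deriv_deriv_pos (hdd ▸ hpos) hd0 hqc
  have hmax' : ∀ᶠ t in 𝓝 (0 : ℝ), q t ≤ q 0 := by
    have := hline0.eventually hmax
    simpa [hq] using this
  have hconst : q =ᶠ[𝓝 0] fun _ => q 0 := by
    filter_upwards [hmin, hmax'] with t h1 h2 using le_antisymm h2 h1
  have h5 : deriv (deriv q) 0 = 0 := by
    rw [hconst.deriv.deriv_eq]
    simp
  rw [← hdd, h5] at hpos
  exact lt_irrefl _ hpos

lemma fieldDeriv_fieldDeriv_eq (hΩ : IsOpen Ω) {V W : Euc n → Euc n} (hW : ContDiffOn ℝ ∞ W Ω)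
    {v : Euc n → ℝ} (hv : ContDiffOn ℝ ∞ v Ω) {x : Euc n} (hx : x ∈ Ω) :
    fieldDeriv V (fieldDeriv W v) x
      = fderiv ℝ (fderiv ℝ v) x (V x) (W x) + fderiv ℝ v x (fderiv ℝ W x (V x)) := by
  have h1 := differentiableAt_of_contDiffOn hΩ (hv.fderiv_of_isOpen hΩ (m := ∞) (by simp)) hx
  have h2 := differentiableAt_of_contDiffOn hΩ hW hx
  have h3 := h1.hasFDerivAt.clm_apply h2.hasFDerivAt
  change fderiv ℝ (fun z => fderiv ℝ v z (W z)) x (V x) = _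
  rw [h3.fderiv]
  simp [add_comm]

/-- Writing `A = star B * B` turns the sum into one of values `D u u`, one vector `u` for each row
of `B`. -/
lemma sum_mul_bilin_nonpos {A : Matrix (Fin n) (Fin n) ℝ} (hA : A.PosSemidef)
    (D : Euc n →L[ℝ] Euc n →L[ℝ] ℝ) (hD : ∀ u, D u u ≤ 0) (e : Fin n → Euc n) :
    ∑ i, ∑ j, A i j * D (e i) (e j) ≤ 0 := by
  open scoped MatrixOrder in
  obtain ⟨B, rfl⟩ := CStarAlgebra.nonneg_iff_eq_star_mul_self.mp hA.nonneg
  have hk : ∀ k, D (∑ i, B k i • e i) (∑ i, B k i • e i)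
      = ∑ j, ∑ i, B k i * B k j * D (e i) (e j) := fun k => by
    rw [map_sum]
    refine Finset.sum_congr rfl fun j _ => ?_
    rw [map_sum, sum_apply]
    refine Finset.sum_congr rfl fun i _ => ?_
    simp only [map_smul, smul_apply, smul_eq_mul]
    ring
  have : ∑ i, ∑ j, (star B * B) i j * D (e i) (e j)
      = ∑ k, D (∑ i, B k i • e i) (∑ i, B k i • e i) := by
    simp_rw [hk]
    symm
    rw [Finset.sum_comm]
    symm
    rw [Finset.sum_comm]
    refine Finset.sum_congr rfl fun j _ => ?_
    symm
    rw [Finset.sum_comm]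
    refine Finset.sum_congr rfl fun i _ => ?_
    rw [Matrix.mul_apply, Finset.sum_mul]
    refine Finset.sum_congr rfl fun k _ => ?_
    simp [Matrix.star_apply]
  rw [this]
  exact Finset.sum_nonpos fun k _ => hD _

/-- In a moving frame `eᵢ eⱼ v` differs from the Hessian term by a derivative of `v` alone, and this
vanishes at a critical point. -/
lemma secondOrderPart_nonpos (hΩ : IsOpen Ω) {e : Fin n → Euc n → Euc n}
    (he : ∀ i, ContDiffOn ℝ ∞ (e i) Ω) {A : Euc n → Matrix (Fin n) (Fin n) ℝ} {v : Euc n → ℝ}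
    (hv : ContDiffOn ℝ ∞ v Ω) {x : Euc n} (hx : x ∈ Ω) (hA : (A x).PosSemidef)
    (hmax : IsLocalMax v x) : secondOrderPart e A v x ≤ 0 := by
  have h := sum_mul_bilin_nonpos hA (fderiv ℝ (fderiv ℝ v) x)
    (fderiv_fderiv_nonpos_of_isLocalMax (hv.contDiffAt (hΩ.mem_nhds hx)) hmax) (fun i => e i x)
  refine le_of_eq_of_le ?_ h
  refine Finset.sum_congr rfl fun i _ => Finset.sum_congr rfl fun j _ => ?_
  rw [fieldDeriv_fieldDeriv_eq hΩ (he j) hv hx, hmax.fderiv_eq_zero]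
  simp

lemma fieldDeriv_add {V : Euc n → Euc n} {f g : Euc n → ℝ} {x : Euc n}
    (hf : DifferentiableAt ℝ f x) (hg : DifferentiableAt ℝ g x) :
    fieldDeriv V (fun z => f z + g z) x = fieldDeriv V f x + fieldDeriv V g x := by
  simp [fieldDeriv, fderiv_fun_add hf hg]

lemma fieldDeriv_const_mul {V : Euc n → Euc n} {f : Euc n → ℝ} {x : Euc n} (c : ℝ)
    (hf : DifferentiableAt ℝ f x) :
    fieldDeriv V (fun z => c * f z) x = c * fieldDeriv V f x := by
  simp [fieldDeriv, fderiv_const_mul hf]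

lemma fieldDeriv_mul {V : Euc n → Euc n} {f g : Euc n → ℝ} {x : Euc n}
    (hf : DifferentiableAt ℝ f x) (hg : DifferentiableAt ℝ g x) :
    fieldDeriv V (fun z => f z * g z) x = f x * fieldDeriv V g x + g x * fieldDeriv V f x := by
  simp [fieldDeriv, fderiv_fun_mul hf hg]

lemma fieldDeriv_congr (hΩ : IsOpen Ω) {V : Euc n → Euc n} {f g : Euc n → ℝ} (h : EqOn f g Ω)
    {x : Euc n} (hx : x ∈ Ω) : fieldDeriv V f x = fieldDeriv V g x := by
  have : f =ᶠ[𝓝 x] g := by filter_upwards [hΩ.mem_nhds hx] with z hz using h hz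
  simp [fieldDeriv, this.fderiv_eq]

lemma secondOrderPart_add_const_mul (hΩ : IsOpen Ω) {e : Fin n → Euc n → Euc n}
    (he : ∀ i, ContDiffOn ℝ ∞ (e i) Ω) (A : Euc n → Matrix (Fin n) (Fin n) ℝ) {f g : Euc n → ℝ}
    (hf : ContDiffOn ℝ ∞ f Ω) (hg : ContDiffOn ℝ ∞ g Ω) (c : ℝ) {x : Euc n} (hx : x ∈ Ω) :
    secondOrderPart e A (fun z => f z + c * g z) x
      = secondOrderPart e A f x + c * secondOrderPart e A g x := by
  have h1 : ∀ j, ∀ z ∈ Ω, fieldDeriv (e j) (fun z => f z + c * g z) z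
      = fieldDeriv (e j) f z + c * fieldDeriv (e j) g z := fun j z hz => by
    rw [fieldDeriv_add (differentiableAt_of_contDiffOn hΩ hf hz)
      ((differentiableAt_of_contDiffOn hΩ hg hz).const_mul c),
      fieldDeriv_const_mul c (differentiableAt_of_contDiffOn hΩ hg hz)]
  simp only [secondOrderPart, Finset.mul_sum, ← Finset.sum_add_distrib]
  refine Finset.sum_congr rfl fun i _ => Finset.sum_congr rfl fun j _ => ?_
  have hf' := differentiableAt_of_contDiffOn hΩ (contDiffOn_fieldDeriv hΩ (he j) hf) hx
  have hg' := differentiableAt_of_contDiffOn hΩ (contDiffOn_fieldDeriv hΩ (he j) hg) hx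
  rw [fieldDeriv_congr hΩ (h1 j) hx, fieldDeriv_add hf' (hg'.const_mul c),
    fieldDeriv_const_mul c hg']
  ring

lemma frameGradient_add_const_mul (e : Fin n → Euc n → Euc n) {f g : Euc n → ℝ} {x : Euc n}
    (hf : DifferentiableAt ℝ f x) (hg : DifferentiableAt ℝ g x) (c : ℝ) :
    frameGradient e (fun z => f z + c * g z) x = frameGradient e f x + c • frameGradient e g x := by
  funext i
  simp [frameGradient, fieldDeriv_add hf (hg.const_mul c), fieldDeriv_const_mul c hg]

lemma contDiffOn_frameGradient (hΩ : IsOpen Ω) {e : Fin n → Euc n → Euc n}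
    (he : ∀ i, ContDiffOn ℝ ∞ (e i) Ω) {f : Euc n → ℝ} (hf : ContDiffOn ℝ ∞ f Ω) :
    ContDiffOn ℝ ∞ (frameGradient e f) Ω :=
  contDiffOn_pi.mpr fun i => contDiffOn_fieldDeriv hΩ (he i) hf

lemma contDiffOn_frozenCoeff (hΩ : IsOpen Ω) {e : Fin n → Euc n → Euc n}
    (he : ∀ i, ContDiffOn ℝ ∞ (e i) Ω) {a : Euc n → (Fin n → ℝ) → Matrix (Fin n) (Fin n) ℝ}
    (ha : ∀ i j, ContDiffOn ℝ ∞ (fun q : Euc n × (Fin n → ℝ) => a q.1 q.2 i j) (Ω ×ˢ univ))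
    {φ : Euc n → ℝ} (hφ : ContDiffOn ℝ ∞ φ Ω) (i j : Fin n) :
    ContDiffOn ℝ ∞ (fun x => frozenCoeff e a φ x i j) Ω :=
  (ha i j).comp (contDiffOn_id.prodMk (contDiffOn_frameGradient hΩ he hφ))
    fun _ hx => ⟨hx, mem_univ _⟩

lemma posSemidef_of_sum_nonneg {A : Matrix (Fin n) (Fin n) ℝ} (hs : ∀ i j, A i j = A j i)
    (hA : ∀ ξ : Fin n → ℝ, 0 ≤ ∑ i, ∑ j, A i j * ξ i * ξ j) : A.PosSemidef := by
  refine Matrix.PosSemidef.of_dotProduct_mulVec_nonneg ?_ fun ξ => ?_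
  · ext i j
    simp [hs i j]
  · refine le_of_le_of_eq (hA ξ) ?_
    simp only [dotProduct, Matrix.mulVec, Finset.mul_sum, star_trivial]
    exact Finset.sum_congr rfl fun i _ => Finset.sum_congr rfl fun j _ => by ring

end SecondOrder

/-! ### Perturbed maxima and the Hopf-type estimate. -/

section Barrier

open Set Filter Topology Metric

variable {n : ℕ} {Ω : Set (Euc n)} {x₀ : Euc n} {e : Fin n → Euc n → Euc n}
  {a : Euc n → (Fin n → ℝ) → Matrix (Fin n) (Fin n) ℝ} {b : Euc n → ℝ → (Fin n → ℝ) → ℝ}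
  {φ ψ h : Euc n → ℝ}

/-- At a local maximum of `φ - ψ + ε h`, the inequality `Qψ ≤ Qφ` bounds the second order part
of `h`. -/
lemma barrier_inequality (hΩ : IsOpen Ω) (he : ∀ i, ContDiffOn ℝ ∞ (e i) Ω)
    (hφ : ContDiffOn ℝ ∞ φ Ω) (hψ : ContDiffOn ℝ ∞ ψ Ω) (hh : ContDiffOn ℝ ∞ h Ω)
    {x : Euc n} (hx : x ∈ Ω) (ha : (frozenCoeff e a φ x).PosSemidef)
    (hQ : frameQuasilinearOp e a b ψ x ≤ frameQuasilinearOp e a b φ x) {ε : ℝ}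
    (hmax : IsLocalMax (fun z => φ z - ψ z + ε * h z) x) :
    frameGradient e ψ x = frameGradient e φ x + ε • frameGradient e h x ∧
    ε * secondOrderPart e (frozenCoeff e a φ) h x
      ≤ ∑ i, ∑ j, (a x (frameGradient e φ x) i j - a x (frameGradient e ψ x) i j)
          * fieldDeriv (e i) (fieldDeriv (e j) ψ) x
        + (b x (φ x) (frameGradient e φ x) - b x (ψ x) (frameGradient e ψ x)) := by
  have hw : (fun z => φ z - ψ z + ε * h z) = fun z => (φ z + (-1) * ψ z) + ε * h z := by
    funext z; ring
  rw [hw] at hmax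
  have hw1 : ContDiffOn ℝ ∞ (fun z => φ z + (-1) * ψ z) Ω := hφ.add (contDiffOn_const.mul hψ)
  have hv : ContDiffOn ℝ ∞ (fun z => (φ z + (-1) * ψ z) + ε * h z) Ω :=
    hw1.add (contDiffOn_const.mul hh)
  have hdφ := differentiableAt_of_contDiffOn hΩ hφ hx
  have hdψ := differentiableAt_of_contDiffOn hΩ hψ hx
  constructor
  · have h0 : frameGradient e (fun z => (φ z + (-1) * ψ z) + ε * h z) x = 0 := by
      funext i
      simp only [frameGradient, fieldDeriv]
      rw [hmax.fderiv_eq_zero]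
      simp
    rw [frameGradient_add_const_mul e (differentiableAt_of_contDiffOn hΩ hw1 hx)
      (differentiableAt_of_contDiffOn hΩ hh hx), frameGradient_add_const_mul e hdφ hdψ] at h0
    rw [← sub_eq_zero, ← neg_eq_zero, ← h0]
    module
  · have h1 := secondOrderPart_nonpos hΩ he hv hx ha hmax
    rw [secondOrderPart_add_const_mul hΩ he _ hw1 hh _ hx,
      secondOrderPart_add_const_mul hΩ he _ hφ hψ _ hx] at h1
    -- The coefficients frozen at `φ` act on the whole difference; the error of freezing them is
    -- charged to the second derivatives of `ψ`.
    have h2 : ∑ i, ∑ j, (a x (frameGradient e φ x) i j - a x (frameGradient e ψ x) i j)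
          * fieldDeriv (e i) (fieldDeriv (e j) ψ) x
        = secondOrderPart e (frozenCoeff e a φ) ψ x - secondOrderPart e (frozenCoeff e a ψ) ψ x := by
      simp only [secondOrderPart, frozenCoeff, sub_mul, Finset.sum_sub_distrib]
    rw [h2]
    simp only [frameQuasilinearOp] at hQ
    linarith

/-- If `h` vanishes at a maximum point `x₀` of `w` and is negative at all other maximum points near
`x₀`, then suitable small perturbations `w + ε h` have local maxima converging to `x₀`. -/
lemma exists_perturbed_maxima (hΩ : IsOpen Ω) (hx₀ : x₀ ∈ Ω) {w : Euc n → ℝ}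
    (hw : ContinuousOn w Ω) (hmax : IsMaxOn w Ω x₀) (hh : ContinuousOn h Ω) (h₀ : h x₀ = 0)
    (hiso : ∀ᶠ x in 𝓝 x₀, w x = w x₀ → 0 ≤ h x → x = x₀) :
    ∃ (z : ℕ → Euc n) (ε : ℕ → ℝ), Tendsto z atTop (𝓝 x₀) ∧ (∀ k, 0 < ε k) ∧
      (∀ᶠ k in atTop, IsLocalMax (fun x => w x + ε k * h x) (z k)) ∧
      ∀ k, w x₀ ≤ w (z k) + ε k * h (z k) := by
  obtain ⟨R, hR, hRs⟩ := nhds_basis_closedBall.mem_iff.mp (inter_mem (hΩ.mem_nhds hx₀) hiso)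
  have hRΩ : closedBall x₀ R ⊆ Ω := fun x hx => (hRs hx).1
  have hcw := hw.mono hRΩ
  have hch := hh.mono hRΩ
  have hex : ∀ k : ℕ, ∃ x ∈ closedBall x₀ R,
      IsMaxOn (fun x => w x + 1 / ((k : ℝ) + 1) * h x) (closedBall x₀ R) x := fun k =>
    (isCompact_closedBall x₀ R).exists_isMaxOn ⟨x₀, mem_closedBall_self hR.le⟩
      (hcw.add (continuousOn_const.mul hch))
  choose y hyR hymax using hex
  obtain ⟨p, hpR, σ, hσ, hlim⟩ := (isCompact_closedBall x₀ R).tendsto_subseq hyR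
  have hge : ∀ k, w x₀ ≤ w (y k) + 1 / ((k : ℝ) + 1) * h (y k) := fun k => by
    have : w x₀ + 1 / ((k : ℝ) + 1) * h x₀ ≤ w (y k) + 1 / ((k : ℝ) + 1) * h (y k) :=
      hymax k (mem_closedBall_self hR.le)
    rwa [h₀, mul_zero, add_zero] at this
  have hεpos : ∀ k : ℕ, 0 < 1 / ((k : ℝ) + 1) := fun k => Nat.one_div_pos_of_nat
  have hlimR : Tendsto (y ∘ σ) atTop (𝓝[closedBall x₀ R] p) :=
    tendsto_nhdsWithin_iff.mpr ⟨hlim, Eventually.of_forall fun k => hyR _⟩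
  have hlw : Tendsto (fun k => w (y (σ k))) atTop (𝓝 (w p)) := (hcw p hpR).tendsto.comp hlimR
  have hlh : Tendsto (fun k => h (y (σ k))) atTop (𝓝 (h p)) := (hch p hpR).tendsto.comp hlimR
  have hlε : Tendsto (fun k => 1 / ((σ k : ℝ) + 1)) atTop (𝓝 0) :=
    tendsto_one_div_add_atTop_nhds_zero_nat.comp hσ.tendsto_atTop
  have hp1 : w x₀ ≤ w p := by
    have h2 := hlw.add (hlε.mul hlh)
    rw [zero_mul, add_zero] at h2
    exact ge_of_tendsto' h2 fun k => hge (σ k)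
  -- Since `w` never exceeds `w x₀`, the perturbed maximum can reach `w x₀` only where `h` is
  -- nonnegative.
  have hp2 : 0 ≤ h p := by
    refine ge_of_tendsto' hlh fun k => ?_
    have h1 := hge (σ k)
    have h2 : w (y (σ k)) ≤ w x₀ := hmax (hRΩ (hyR _))
    exact nonneg_of_mul_nonneg_right (by linarith) (hεpos (σ k))
  have hp : p = x₀ := (hRs hpR).2 (le_antisymm (hmax (hRΩ hpR)) hp1) hp2
  subst hp
  refine ⟨y ∘ σ, fun k => 1 / ((σ k : ℝ) + 1), hlim, fun k => hεpos (σ k), ?_, fun k => hge (σ k)⟩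
  filter_upwards [hlim (ball_mem_nhds p hR)] with k hk
  exact (hymax (σ k)).isLocalMax (mem_of_superset (isOpen_ball.mem_nhds hk) ball_subset_closedBall)

lemma exists_lipschitz_coeff (hΩ : IsOpen Ω)
    (ha : ∀ i j, ContDiffOn ℝ ∞ (fun q : Euc n × (Fin n → ℝ) => a q.1 q.2 i j) (Ω ×ˢ univ))
    (hx₀ : x₀ ∈ Ω) (p₀ : Fin n → ℝ) : ∃ K ≥ 0, ∃ T ∈ 𝓝 (x₀, p₀), ∀ x p p', (x, p) ∈ T →
      (x, p') ∈ T → ∀ i j, |a x p i j - a x p' i j| ≤ K * ‖p - p'‖ := by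
  have h1 : ContDiffOn ℝ ∞ (fun q : Euc n × (Fin n → ℝ) => fun i j => a q.1 q.2 i j)
      (Ω ×ˢ univ) := contDiffOn_pi.mpr fun i => contDiffOn_pi.mpr fun j => ha i j
  have h2 := h1.contDiffAt ((hΩ.prod isOpen_univ).mem_nhds (mk_mem_prod hx₀ (mem_univ p₀)))
  obtain ⟨K, T, hT, hK⟩ := (h2.of_le (by norm_cast : (1 : WithTop ℕ∞) ≤ ∞)).exists_lipschitzOnWith
  refine ⟨K, K.2, T, hT, fun x p p' hp hp' i j => ?_⟩
  have h3 := hK.dist_le_mul _ hp _ hp'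
  have h4 : dist ((x, p) : Euc n × (Fin n → ℝ)) (x, p') = ‖p - p'‖ := by
    rw [Prod.dist_eq, dist_self, dist_eq_norm, max_eq_right (norm_nonneg _)]
  rw [h4] at h3
  refine le_trans ?_ h3
  exact (dist_le_pi_dist (fun j => a x p i j) (fun j => a x p' i j) j).trans
    (dist_le_pi_dist (fun i j => a x p i j) (fun i j => a x p' i j) i)

lemma exists_lipschitz_lower_order (hΩ : IsOpen Ω)
    (hb : ContDiffOn ℝ ∞ (fun q : Euc n × ℝ × (Fin n → ℝ) => b q.1 q.2.1 q.2.2) (Ω ×ˢ univ))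
    (hx₀ : x₀ ∈ Ω) (z₀ : ℝ) (p₀ : Fin n → ℝ) : ∃ K ≥ 0, ∃ T ∈ 𝓝 (x₀, z₀, p₀),
      ∀ x z z' p p', (x, z, p) ∈ T → (x, z', p') ∈ T →
        |b x z p - b x z' p'| ≤ K * (|z - z'| + ‖p - p'‖) := by
  have h2 := hb.contDiffAt ((hΩ.prod isOpen_univ).mem_nhds
    (mk_mem_prod hx₀ (mem_univ (z₀, p₀))))
  obtain ⟨K, T, hT, hK⟩ := (h2.of_le (by norm_cast : (1 : WithTop ℕ∞) ≤ ∞)).exists_lipschitzOnWith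
  refine ⟨K, K.2, T, hT, fun x z z' p p' hp hp' => ?_⟩
  refine (hK.dist_le_mul _ hp _ hp').trans (mul_le_mul_of_nonneg_left ?_ K.2)
  rw [Prod.dist_eq, dist_self, Prod.dist_eq, max_eq_right (by positivity), Real.dist_eq,
    dist_eq_norm]
  exact max_le_add_of_nonneg (abs_nonneg _) (norm_nonneg _)

/-- Hopf-type estimate: if `h` vanishes at a nonnegative maximum point `x₀` of `φ - ψ` and is
negative at all other maximum points near `x₀`, then the second order part of `h` at `x₀` is
bounded by the gradient of `h` at `x₀`, with a constant independent of `h`. -/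
lemma exists_secondOrderPart_le (hΩ : IsOpen Ω) (he : ∀ i, ContDiffOn ℝ ∞ (e i) Ω)
    (ha_smooth : ∀ i j, ContDiffOn ℝ ∞ (fun q : Euc n × (Fin n → ℝ) => a q.1 q.2 i j)
      (Ω ×ˢ univ))
    (hb_smooth : ContDiffOn ℝ ∞ (fun q : Euc n × ℝ × (Fin n → ℝ) => b q.1 q.2.1 q.2.2)
      (Ω ×ˢ univ))
    (ha : ∀ x ∈ Ω, ∀ p, (a x p).PosSemidef)
    (hb_mono : ∀ x ∈ Ω, ∀ p, Antitone fun z => b x z p)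
    (hφ : ContDiffOn ℝ ∞ φ Ω) (hψ : ContDiffOn ℝ ∞ ψ Ω)
    (hQ : ∀ x ∈ Ω, frameQuasilinearOp e a b ψ x ≤ frameQuasilinearOp e a b φ x)
    (hx₀ : x₀ ∈ Ω) (hmax : IsMaxOn (fun x => φ x - ψ x) Ω x₀) (h0 : 0 ≤ φ x₀ - ψ x₀) :
    ∃ C, ∀ h : Euc n → ℝ, ContDiffOn ℝ ∞ h Ω → h x₀ = 0 →
      (∀ᶠ x in 𝓝 x₀, φ x - ψ x = φ x₀ - ψ x₀ → 0 ≤ h x → x = x₀) →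
      secondOrderPart e (frozenCoeff e a φ) h x₀ ≤ C * ‖frameGradient e h x₀‖ := by
  obtain ⟨Ka, hKa, Ta, hTa, hLa⟩ := exists_lipschitz_coeff hΩ ha_smooth hx₀ (frameGradient e φ x₀)
  obtain ⟨Kb, hKb, Tb, hTb, hLb⟩ :=
    exists_lipschitz_lower_order hΩ hb_smooth hx₀ (φ x₀) (frameGradient e φ x₀)
  set S : Euc n → ℝ := fun x => ∑ i, ∑ j, |fieldDeriv (e i) (fieldDeriv (e j) ψ) x| with hS
  refine ⟨Ka * S x₀ + Kb, fun h hh hh0 hiso => ?_⟩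
  have cont : ∀ {G : Type} [NormedAddCommGroup G] [NormedSpace ℝ G] {f : Euc n → G},
      ContDiffOn ℝ ∞ f Ω → ContinuousAt f x₀ := fun hf =>
    hf.continuousOn.continuousAt (hΩ.mem_nhds hx₀)
  have cφ := cont hφ
  have cψ := cont hψ
  -- At the perturbed maxima `φ - ψ` may be slightly negative, by at most `ε |h|`. By monotonicity
  -- `b` at `ψ` may be replaced by `b` at `max φ ψ`, which lies within that distance of `φ`.
  have cm : ContinuousAt (fun x => max (φ x) (ψ x)) x₀ := Tendsto.max cφ cψ
  have cgφ := cont (contDiffOn_frameGradient hΩ he hφ)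
  have cgψ := cont (contDiffOn_frameGradient hΩ he hψ)
  have cgh := cont (contDiffOn_frameGradient hΩ he hh)
  have hgrad : frameGradient e ψ x₀ = frameGradient e φ x₀ := by
    have hloc : IsLocalMax (fun x => φ x - ψ x) x₀ := hmax.isLocalMax (hΩ.mem_nhds hx₀)
    have h1 := hloc.fderiv_eq_zero
    rw [fderiv_fun_sub (differentiableAt_of_contDiffOn hΩ hφ hx₀)
      (differentiableAt_of_contDiffOn hΩ hψ hx₀), sub_eq_zero] at h1
    funext i
    simp [frameGradient, fieldDeriv, h1]
  obtain ⟨z, ε, hz, hε, hzmax, hzge⟩ := exists_perturbed_maxima hΩ hx₀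
    (hφ.sub hψ).continuousOn hmax hh.continuousOn hh0 hiso
  have cS : ContinuousAt S x₀ := by
    refine tendsto_finsetSum _ fun i _ => tendsto_finsetSum _ fun j _ => ?_
    exact (cont (contDiffOn_fieldDeriv hΩ (he i) (contDiffOn_fieldDeriv hΩ (he j) hψ))).abs
  have cL : ContinuousAt (secondOrderPart e (frozenCoeff e a φ) h) x₀ := by
    refine tendsto_finsetSum _ fun i _ => tendsto_finsetSum _ fun j _ => ?_
    exact (cont (contDiffOn_frozenCoeff hΩ he ha_smooth hφ i j)).mul
      (cont (contDiffOn_fieldDeriv hΩ (he i) (contDiffOn_fieldDeriv hΩ (he j) hh)))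
  have e1 : ∀ᶠ x in 𝓝 x₀, (x, frameGradient e φ x) ∈ Ta := (continuousAt_id.prodMk cgφ) hTa
  have e2 : ∀ᶠ x in 𝓝 x₀, (x, frameGradient e ψ x) ∈ Ta :=
    (continuousAt_id.prodMk cgψ) (by simpa [hgrad] using hTa)
  have e3 : ∀ᶠ x in 𝓝 x₀, (x, φ x, frameGradient e φ x) ∈ Tb :=
    (continuousAt_id.prodMk (cφ.prodMk cgφ)) hTb
  have e4 : ∀ᶠ x in 𝓝 x₀, (x, max (φ x) (ψ x), frameGradient e ψ x) ∈ Tb :=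
    (continuousAt_id.prodMk (cm.prodMk cgψ))
      (by simpa [hgrad, max_eq_left (sub_nonneg.mp h0)] using hTb)
  have key : ∀ᶠ k in atTop, secondOrderPart e (frozenCoeff e a φ) h (z k)
      ≤ Ka * S (z k) * ‖frameGradient e h (z k)‖
        + Kb * (|h (z k)| + ‖frameGradient e h (z k)‖) := by
    filter_upwards [hzmax, hz (hΩ.mem_nhds hx₀), hz.eventually e1, hz.eventually e2,
      hz.eventually e3, hz.eventually e4] with k hk hkΩ k1 k2 k3 k4
    obtain ⟨hg, hle⟩ := barrier_inequality hΩ he hφ hψ hh hkΩ (ha _ hkΩ _) (hQ _ hkΩ) hk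
    have hεk := hε k
    set x := z k
    set N := ‖frameGradient e h x‖
    have hgn : ‖frameGradient e φ x - frameGradient e ψ x‖ = ε k * N := by
      rw [hg, sub_add_cancel_left, norm_neg, norm_smul, Real.norm_eq_abs, abs_of_pos hεk]
    have hA : ∑ i, ∑ j, (a x (frameGradient e φ x) i j - a x (frameGradient e ψ x) i j)
          * fieldDeriv (e i) (fieldDeriv (e j) ψ) x ≤ Ka * (ε k * N) * S x := by
      rw [hS]
      simp only [Finset.mul_sum]
      refine Finset.sum_le_sum fun i _ => Finset.sum_le_sum fun j _ => ?_
      refine (le_abs_self _).trans ?_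
      rw [abs_mul]
      refine mul_le_mul_of_nonneg_right ?_ (abs_nonneg _)
      rw [← hgn]
      exact hLa _ _ _ k1 k2 i j
    have hB : b x (φ x) (frameGradient e φ x) - b x (ψ x) (frameGradient e ψ x)
        ≤ Kb * (ε k * |h x| + ε k * N) := by
      have h1 := hb_mono x hkΩ (frameGradient e ψ x) (le_max_right (φ x) (ψ x))
      simp only at h1
      have h2 := (le_abs_self _).trans (hLb _ _ _ _ _ k3 k4)
      rw [hgn] at h2
      have h3 : |φ x - max (φ x) (ψ x)| ≤ ε k * |h x| := by
        have h4 := hzge k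
        have h5 : ε k * h x ≤ ε k * |h x| := mul_le_mul_of_nonneg_left (le_abs_self _) hεk.le
        have h6 : 0 ≤ ε k * |h x| := by positivity
        rw [abs_sub_comm, abs_of_nonneg (sub_nonneg.mpr (le_max_left _ _))]
        rcases max_cases (φ x) (ψ x) with ⟨h7, _⟩ | ⟨h7, _⟩ <;> rw [h7] <;> linarith
      have h8 : Kb * (|φ x - max (φ x) (ψ x)| + ε k * N) ≤ Kb * (ε k * |h x| + ε k * N) :=
        mul_le_mul_of_nonneg_left (by linarith) hKb
      linarith
    -- The two gradients differ exactly by `ε k` times the gradient of `h`, so every error term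
    -- carries a factor `ε k` that can be divided out.
    refine le_of_mul_le_mul_left ?_ hεk
    calc ε k * secondOrderPart e (frozenCoeff e a φ) h x
        ≤ Ka * (ε k * N) * S x + Kb * (ε k * |h x| + ε k * N) := hle.trans (add_le_add hA hB)
      _ = ε k * (Ka * S x * N + Kb * (|h x| + N)) := by ring
  have lim1 : Tendsto (fun k => secondOrderPart e (frozenCoeff e a φ) h (z k)) atTop
      (𝓝 (secondOrderPart e (frozenCoeff e a φ) h x₀)) := cL.tendsto.comp hz
  have lim2 : Tendsto (fun k => Ka * S (z k) * ‖frameGradient e h (z k)‖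
      + Kb * (|h (z k)| + ‖frameGradient e h (z k)‖)) atTop
      (𝓝 (Ka * S x₀ * ‖frameGradient e h x₀‖ + Kb * (|h x₀| + ‖frameGradient e h x₀‖))) :=
    (((cS.tendsto.comp hz).const_mul Ka).mul (cgh.tendsto.comp hz).norm).add
      ((((cont hh).tendsto.comp hz).abs.add (cgh.tendsto.comp hz).norm).const_mul Kb)
  have h1 := le_of_tendsto_of_tendsto lim1 lim2 key
  rw [hh0, abs_zero, zero_add] at h1
  linarith

end Barrier

/-! ### Tangency of the generating fields and propagation of maxima. -/

section MaximumPropagation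

open Set Filter Topology Metric

variable {n r : ℕ} {Ω : Set (Euc n)} {x₀ : Euc n} {e : Fin n → Euc n → Euc n}
  {a : Euc n → (Fin n → ℝ) → Matrix (Fin n) (Fin n) ℝ} {b : Euc n → ℝ → (Fin n → ℝ) → ℝ}
  {φ ψ : Euc n → ℝ}

lemma fieldDeriv_add_const_mul_sq {V : Euc n → Euc n} {s : Euc n → ℝ} {x : Euc n} (K : ℝ)
    (hs : DifferentiableAt ℝ s x) :
    fieldDeriv V (fun z => s z + K * (s z * s z)) x = (1 + 2 * K * s x) * fieldDeriv V s x := by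
  rw [fieldDeriv_add hs ((hs.fun_mul hs).const_mul K), fieldDeriv_const_mul K (hs.fun_mul hs),
    fieldDeriv_mul hs hs]
  ring

/-- Where `s` vanishes, the quadratic term contributes the square of a first derivative, with a free
factor `K`, to the second derivative. -/
lemma fieldDeriv_fieldDeriv_add_const_mul_sq (hΩ : IsOpen Ω) {V : Euc n → Euc n}
    (hV : ContDiffOn ℝ ∞ V Ω) {s : Euc n → ℝ} (hs : ContDiffOn ℝ ∞ s Ω) (hx₀ : x₀ ∈ Ω)
    (h0 : s x₀ = 0) (K : ℝ) :
    fieldDeriv V (fieldDeriv V fun z => s z + K * (s z * s z)) x₀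
      = 2 * K * fieldDeriv V s x₀ ^ 2 + fieldDeriv V (fieldDeriv V s) x₀ := by
  have h1 : EqOn (fieldDeriv V fun z => s z + K * (s z * s z))
      (fun x => fieldDeriv V s x + (2 * K) * (s x * fieldDeriv V s x)) Ω := fun x hx => by
    rw [fieldDeriv_add_const_mul_sq K (differentiableAt_of_contDiffOn hΩ hs hx)]
    ring
  have hd := differentiableAt_of_contDiffOn hΩ hs hx₀
  have hd' := differentiableAt_of_contDiffOn hΩ (contDiffOn_fieldDeriv hΩ hV hs) hx₀
  rw [fieldDeriv_congr hΩ h1 hx₀, fieldDeriv_add hd' ((hd.fun_mul hd').const_mul _),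
    fieldDeriv_const_mul _ (hd.fun_mul hd'), fieldDeriv_mul hd hd', h0]
  ring

lemma nonpos_of_forall_nat_mul_le {A B : ℝ} (h : ∀ k : ℕ, k * A ≤ B) : A ≤ 0 := by
  by_contra! hA
  obtain ⟨k, hk⟩ := exists_nat_gt (B / A)
  exact absurd (h k) (not_le.mpr ((div_lt_iff₀ hA).mp hk))

/-- The fields of a sum of squares decomposition annihilate every function vanishing at a
nonnegative maximum point of `φ - ψ` and negative at all other maximum points. -/
lemma fieldDeriv_eq_zero_of_neg_on_maxima (hΩ : IsOpen Ω) (he : ∀ i, ContDiffOn ℝ ∞ (e i) Ω)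
    (ha_smooth : ∀ i j, ContDiffOn ℝ ∞ (fun q : Euc n × (Fin n → ℝ) => a q.1 q.2 i j)
      (Ω ×ˢ univ))
    (hb_smooth : ContDiffOn ℝ ∞ (fun q : Euc n × ℝ × (Fin n → ℝ) => b q.1 q.2.1 q.2.2)
      (Ω ×ˢ univ))
    (ha : ∀ x ∈ Ω, ∀ p, (a x p).PosSemidef)
    (hb_mono : ∀ x ∈ Ω, ∀ p, Antitone fun z => b x z p)
    (hφ : ContDiffOn ℝ ∞ φ Ω) (hψ : ContDiffOn ℝ ∞ ψ Ω)
    (hQ : ∀ x ∈ Ω, frameQuasilinearOp e a b ψ x ≤ frameQuasilinearOp e a b φ x)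
    {X : Fin r → Euc n → Euc n} {Y : Euc n → Euc n}
    (hX : IsSumOfSquares Ω e (frozenCoeff e a φ) X Y)
    (hx₀ : x₀ ∈ Ω) (hmax : IsMaxOn (fun x => φ x - ψ x) Ω x₀) (h0 : 0 ≤ φ x₀ - ψ x₀)
    {s : Euc n → ℝ} (hs : ContDiffOn ℝ ∞ s Ω) (hs0 : s x₀ = 0)
    (hneg : ∀ᶠ x in 𝓝 x₀, φ x - ψ x = φ x₀ - ψ x₀ → x ≠ x₀ → s x < 0) (k : Fin r) :
    fieldDeriv (X k) s x₀ = 0 := by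
  obtain ⟨C, hC⟩ := exists_secondOrderPart_le hΩ he ha_smooth hb_smooth ha hb_mono hφ hψ hQ hx₀
    hmax h0
  have hsd := differentiableAt_of_contDiffOn hΩ hs hx₀
  have hbound : ∀ K : ℕ, (K : ℝ) * (2 * ∑ k, fieldDeriv (X k) s x₀ ^ 2)
      ≤ C * ‖frameGradient e s x₀‖
        - (∑ k, fieldDeriv (X k) (fieldDeriv (X k) s) x₀ + fieldDeriv Y s x₀) := by
    intro K
    have hh : ContDiffOn ℝ ∞ (fun z => s z + K * (s z * s z)) Ω :=
      hs.add (contDiffOn_const.mul (hs.mul hs))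
    -- Close to `x₀` the factor in `s * (1 + K * s)` is positive, so the modified function is
    -- negative wherever `s` is. The neighbourhood may depend on `K`, but `C` does not.
    have h1 := hC _ hh (by simp [hs0]) (by
      have hsm : ∀ᶠ x in 𝓝 x₀, |K * s x| < 1 := by
        have : ContinuousAt (fun x => |K * s x|) x₀ := (hsd.continuousAt.const_mul _).abs
        exact this.eventually_lt_const (by simp [hs0])
      filter_upwards [hneg, hsm] with x hx1 hx2 hx3 hx4
      by_contra hne
      have h2 := hx1 hx3 hne
      have h3 := (abs_lt.mp hx2).1
      nlinarith)
    rw [hX.2.2 _ hh x₀ hx₀] at h1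
    simp only [fieldDeriv_fieldDeriv_add_const_mul_sq hΩ (hX.1 _) hs hx₀ hs0,
      fieldDeriv_add_const_mul_sq _ hsd, hs0, Finset.sum_add_distrib, ← Finset.mul_sum] at h1
    have h2 : frameGradient e (fun z => s z + K * (s z * s z)) x₀ = frameGradient e s x₀ := by
      funext i
      simp [frameGradient, fieldDeriv_add_const_mul_sq _ hsd, hs0]
    rw [h2] at h1
    linarith
  have h1 := nonpos_of_forall_nat_mul_le hbound
  have h2 : ∑ k, fieldDeriv (X k) s x₀ ^ 2 = 0 :=
    le_antisymm (by linarith) (Finset.sum_nonneg fun _ _ => sq_nonneg _)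
  have h3 := (Finset.sum_eq_zero_iff_of_nonneg fun _ _ => sq_nonneg _).mp h2 k (Finset.mem_univ k)
  exact pow_eq_zero_iff two_ne_zero |>.mp h3

/-- The set of points of `Ω` where `w` attains a nonnegative maximum over `Ω`. -/
def nonnegMaxSet (Ω : Set (Euc n)) (w : Euc n → ℝ) : Set (Euc n) :=
  {x | x ∈ Ω ∧ IsMaxOn w Ω x ∧ 0 ≤ w x}

lemma mem_nonnegMaxSet_of_mem_closure {w : Euc n → ℝ} (hΩ : IsOpen Ω) (hw : ContinuousOn w Ω)
    {x : Euc n} (hx : x ∈ Ω) (hcl : x ∈ closure (nonnegMaxSet Ω w)) : x ∈ nonnegMaxSet Ω w := by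
  obtain ⟨u, hu, hlim⟩ := mem_closure_iff_seq_limit.mp hcl
  have h1 : Tendsto (fun k => w (u k)) atTop (𝓝 (w x)) :=
    (hw.continuousAt (hΩ.mem_nhds hx)).tendsto.comp hlim
  exact ⟨hx, fun y hy => ge_of_tendsto' h1 fun k => (hu k).2.1 hy,
    ge_of_tendsto' h1 fun k => (hu k).2.2⟩

/-- The test function is `‖x - y‖² - ‖z - y‖² - ‖z - x‖²`. On `F` the first two terms together are
nonpositive because `x` is nearest to `y`; the last makes the sign strict for `z ≠ x` without
changing the gradient `2 (y - x)` at `x`. -/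
lemma isTangentTo_of_isSumOfSquares (hΩ : IsOpen Ω) (he : ∀ i, ContDiffOn ℝ ∞ (e i) Ω)
    (ha_smooth : ∀ i j, ContDiffOn ℝ ∞ (fun q : Euc n × (Fin n → ℝ) => a q.1 q.2 i j)
      (Ω ×ˢ univ))
    (hb_smooth : ContDiffOn ℝ ∞ (fun q : Euc n × ℝ × (Fin n → ℝ) => b q.1 q.2.1 q.2.2)
      (Ω ×ˢ univ))
    (ha : ∀ x ∈ Ω, ∀ p, (a x p).PosSemidef)
    (hb_mono : ∀ x ∈ Ω, ∀ p, Antitone fun z => b x z p)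
    (hφ : ContDiffOn ℝ ∞ φ Ω) (hψ : ContDiffOn ℝ ∞ ψ Ω)
    (hQ : ∀ x ∈ Ω, frameQuasilinearOp e a b ψ x ≤ frameQuasilinearOp e a b φ x)
    {X : Fin r → Euc n → Euc n} {Y : Euc n → Euc n}
    (hX : IsSumOfSquares Ω e (frozenCoeff e a φ) X Y) (k : Fin r) :
    IsTangentTo (nonnegMaxSet Ω fun x => φ x - ψ x) (X k) := by
  intro x hx y hy
  have hder : ∀ z : Euc n, HasFDerivAt (fun z : Euc n => ‖x - y‖ ^ 2 - ‖z - y‖ ^ 2 - ‖z - x‖ ^ 2)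
      (-(2 • innerSL ℝ (z - y)) - 2 • innerSL ℝ (z - x)) z := fun z => by
    have h1 := ((hasFDerivAt_id z).sub_const y).norm_sq
    have h2 := ((hasFDerivAt_id z).sub_const x).norm_sq
    exact (h1.const_sub (‖x - y‖ ^ 2)).sub h2
  have hs : ContDiffOn ℝ ∞ (fun z : Euc n => ‖x - y‖ ^ 2 - ‖z - y‖ ^ 2 - ‖z - x‖ ^ 2) Ω :=
    ((contDiff_const.sub ((contDiff_id.sub contDiff_const).norm_sq ℝ)).sub
      ((contDiff_id.sub contDiff_const).norm_sq ℝ)).contDiffOn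
  have := fieldDeriv_eq_zero_of_neg_on_maxima hΩ he ha_smooth hb_smooth ha hb_mono hφ hψ hQ hX
    hx.1 hx.2.1 hx.2.2 hs (by simp) (by
      filter_upwards [hΩ.mem_nhds hx.1] with z hzΩ hz hne
      have hzF : z ∈ nonnegMaxSet Ω fun x => φ x - ψ x := by
        refine ⟨hzΩ, fun u hu => ?_, hx.2.2.trans_eq hz.symm⟩
        have h1 : φ u - ψ u ≤ φ x - ψ x := hx.2.1 hu
        exact h1.trans_eq hz.symm
      have h1 := hy z hzF
      rw [dist_eq_norm, dist_eq_norm] at h1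
      have h2 := pow_le_pow_left₀ (norm_nonneg _) h1 2
      have h3 : 0 < ‖z - x‖ ^ 2 := by
        have := norm_pos_iff.mpr (sub_ne_zero.mpr hne)
        positivity
      linarith) k
  rw [fieldDeriv, (hder x).fderiv] at this
  simp only [sub_self, map_zero, smul_zero, sub_zero, neg_apply, smul_apply, innerSL_apply_apply,
    nsmul_eq_mul, Nat.cast_ofNat] at this
  rw [real_inner_comm, ← neg_sub, inner_neg_left]
  linarith

lemma LieSpan.contDiffOn_and_isTangentTo (hΩ : IsOpen Ω) {F : Set (Euc n)} (hFΩ : F ⊆ Ω)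
    (hFc : ∀ x ∈ Ω, x ∈ closure F → x ∈ F) {X : Fin r → Euc n → Euc n}
    (hX : ∀ k, ContDiffOn ℝ ∞ (X k) Ω) (hXF : ∀ k, IsTangentTo F (X k)) {Z : Euc n → Euc n}
    (hZ : LieSpan Ω X Z) : ContDiffOn ℝ ∞ Z Ω ∧ IsTangentTo F Z := by
  induction hZ with
  | gen k => exact ⟨hX k, hXF k⟩
  | zero => exact ⟨contDiffOn_const, fun x _ y _ => inner_zero_left _⟩
  | add _ _ hV hW =>
    refine ⟨hV.1.add hW.1, fun x hx y hy => ?_⟩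
    rw [inner_add_left, hV.2 x hx y hy, hW.2 x hx y hy, add_zero]
  | smul hg _ hV =>
    refine ⟨hg.smul hV.1, fun x hx y hy => ?_⟩
    rw [real_inner_smul_left, hV.2 x hx y hy, mul_zero]
  | bracket _ _ hV hW =>
    exact ⟨contDiffOn_lieBracket hΩ hV.1 hW.1, hV.2.lieBracket hΩ hFΩ hFc hV.1 hW.1 hW.2⟩
  | congr hVW _ hV =>
    refine ⟨hV.1.congr fun x hx => (hVW hx).symm, fun x hx y hy => ?_⟩
    rw [← hVW (hFΩ hx), hV.2 x hx y hy]

/-- Maximum propagation for a quasilinear operator written in a moving frame whose frozen second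
order part is a sum of squares. -/
lemma maxPropagates_of_isSumOfSquares (hΩ : IsOpen Ω) (he : ∀ i, ContDiffOn ℝ ∞ (e i) Ω)
    (ha_smooth : ∀ i j, ContDiffOn ℝ ∞ (fun q : Euc n × (Fin n → ℝ) => a q.1 q.2 i j)
      (Ω ×ˢ univ))
    (hb_smooth : ContDiffOn ℝ ∞ (fun q : Euc n × ℝ × (Fin n → ℝ) => b q.1 q.2.1 q.2.2)
      (Ω ×ˢ univ))
    (ha : ∀ x ∈ Ω, ∀ p, (a x p).PosSemidef)
    (hb_mono : ∀ x ∈ Ω, ∀ p, Antitone fun z => b x z p)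
    (hφ : ContDiffOn ℝ ∞ φ Ω) (hψ : ContDiffOn ℝ ∞ ψ Ω)
    (hQ : ∀ x ∈ Ω, frameQuasilinearOp e a b ψ x ≤ frameQuasilinearOp e a b φ x)
    {X : Fin r → Euc n → Euc n} {Y : Euc n → Euc n}
    (hX : IsSumOfSquares Ω e (frozenCoeff e a φ) X Y) :
    MaxPropagates Ω X (fun x => φ x - ψ x) := by
  rintro Z hZ I Γ hI hΓΩ hΓ ⟨t₀, ht₀, hmax, h0⟩ t ht
  have hFc : ∀ x ∈ Ω, x ∈ closure (nonnegMaxSet Ω fun x => φ x - ψ x) →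
      x ∈ nonnegMaxSet Ω fun x => φ x - ψ x := fun x hx =>
    mem_nonnegMaxSet_of_mem_closure hΩ (hφ.sub hψ).continuousOn hx
  obtain ⟨hZs, hZF⟩ := hZ.contDiffOn_and_isTangentTo hΩ (fun x hx => hx.1) hFc hX.1
    (isTangentTo_of_isSumOfSquares hΩ he ha_smooth hb_smooth ha hb_mono hφ hψ hQ hX)
  exact (hZF.mem_of_isIntegralCurveOn hΩ hFc hZs hI hΓΩ hΓ ht₀ ⟨hΓΩ ht₀, hmax, h0⟩ t ht).2.1

end MaximumPropagation

/-! ### Smooth factorization of semidefinite matrices of constant rank. -/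

section ConstantRank

open Set Matrix

variable {n : ℕ} {Ω : Set (Euc n)}

/-- A symmetric matrix is diagonalizable, so the multiplicity of 0 as a root is the dimension of the
kernel; `q` collects the nonzero eigenvalues. -/
lemma exists_charpoly_eq_X_pow_mul {A : Matrix (Fin n) (Fin n) ℝ} (hA : A.IsHermitian) {ρ : ℕ}
    (hρ : A.rank = ρ) :
    ∃ q : Polynomial ℝ, A.charpoly = Polynomial.X ^ (n - ρ) * q ∧ q.coeff 0 ≠ 0 := by
  refine ⟨∏ i with ¬ hA.eigenvalues i = 0, (Polynomial.X - Polynomial.C (hA.eigenvalues i)), ?_, ?_⟩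
  · have h1 : A.charpoly = ∏ i, (Polynomial.X - Polynomial.C (hA.eigenvalues i)) := hA.charpoly_eq
    have hcard : Finset.card {i | hA.eigenvalues i = 0} = n - ρ := by
      have h2 := hA.rank_eq_card_non_zero_eigs
      rw [Fintype.card_subtype, hρ] at h2
      have h3 := Finset.card_filter_add_card_filter_not (s := (Finset.univ : Finset (Fin n)))
        (fun i => hA.eigenvalues i = 0)
      rw [Finset.card_univ, Fintype.card_fin] at h3
      simp only [ne_eq] at h2
      omega
    rw [h1, ← Finset.prod_filter_mul_prod_filter_not Finset.univ (fun i => hA.eigenvalues i = 0),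
      ← hcard]
    congr 1
    rw [← Finset.prod_const]
    refine Finset.prod_congr rfl fun i hi => ?_
    rw [(Finset.mem_filter.mp hi).2, map_zero, sub_zero]
  · rw [Polynomial.coeff_zero_eq_eval_zero, Polynomial.eval_prod, Finset.prod_ne_zero_iff]
    intro i hi
    simpa using (Finset.mem_filter.mp hi).2

lemma mul_eq_zero_of_pow_succ_mul_eq_zero {A M : Matrix (Fin n) (Fin n) ℝ} (hA : A.IsHermitian) :
    ∀ d : ℕ, A ^ (d + 1) * M = 0 → A * M = 0
  | 0, h => by simpa using h
  | d + 1, h => by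
    refine mul_eq_zero_of_pow_succ_mul_eq_zero hA d ?_
    have h1 : Aᴴ * A * (A ^ d * M) = 0 := by
      rw [hA.eq, ← h]
      simp only [← mul_assoc, pow_succ']
    rw [conjTranspose_mul_self_mul_eq_zero] at h1
    rw [pow_succ', mul_assoc, h1]

/-- The orthogonal projection onto the kernel of a symmetric matrix whose kernel has dimension `d`,
written as a polynomial in the matrix. -/
noncomputable def kernelProjection (d : ℕ) (A : Matrix (Fin n) (Fin n) ℝ) :
    Matrix (Fin n) (Fin n) ℝ :=
  (A.charpoly.coeff d)⁻¹ • ∑ k ∈ Finset.range (n + 1), A.charpoly.coeff (k + d) • A ^ k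

lemma transpose_kernelProjection (d : ℕ) {A : Matrix (Fin n) (Fin n) ℝ} (hA : A.IsHermitian) :
    (kernelProjection d A)ᵀ = kernelProjection d A := by
  have : Aᵀ = A := by simpa [conjTranspose_eq_transpose_of_trivial] using hA.eq
  simp [kernelProjection, transpose_smul, transpose_sum, transpose_pow, this]

lemma charpoly_coeff_ne_zero {A : Matrix (Fin n) (Fin n) ℝ} (hA : A.IsHermitian) {ρ : ℕ}
    (hρ : A.rank = ρ) : A.charpoly.coeff (n - ρ) ≠ 0 := by
  obtain ⟨q, hq, hq0⟩ := exists_charpoly_eq_X_pow_mul hA hρ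
  have := Polynomial.coeff_X_pow_mul q (n - ρ) 0
  rw [zero_add, ← hq] at this
  rwa [this]

/-- With the characteristic polynomial equal to `X ^ (n - ρ) * q`, the matrix is `q(A) / q(0)`.
Cayley–Hamilton and symmetry give `A * q(A) = 0`; splitting off the constant term of `q` gives the
second form. Together they say that this is a projection onto the kernel. -/
lemma kernelProjection_spec {A : Matrix (Fin n) (Fin n) ℝ} (hA : A.IsHermitian) {ρ : ℕ}
    (hρ : A.rank = ρ) : A * kernelProjection (n - ρ) A = 0 ∧
      ∃ N, kernelProjection (n - ρ) A = 1 + N * A := by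
  obtain ⟨q, hq, hq0⟩ := exists_charpoly_eq_X_pow_mul hA hρ
  have hc : ∀ k, A.charpoly.coeff (k + (n - ρ)) = q.coeff k := fun k => by
    rw [hq, Polynomial.coeff_X_pow_mul]
  have hc0 : A.charpoly.coeff (n - ρ) = q.coeff 0 := by simpa using hc 0
  have hdeg : q.natDegree < n + 1 := by
    have h1 : A.charpoly.natDegree = n := by simp [charpoly_natDegree_eq_dim]
    have hq1 : q ≠ 0 := fun h => hq0 (by simp [h])
    rw [hq, Polynomial.natDegree_X_pow_mul _ hq1] at h1
    omega
  have hP : kernelProjection (n - ρ) A = (q.coeff 0)⁻¹ • Polynomial.aeval A q := by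
    rw [kernelProjection, Polynomial.aeval_eq_sum_range' hdeg, hc0]
    simp only [hc]
  constructor
  · have h1 : A ^ (n - ρ) * Polynomial.aeval A q = 0 := by
      have := aeval_self_charpoly A
      rwa [hq, map_mul, map_pow, Polynomial.aeval_X] at this
    have h2 : A * Polynomial.aeval A q = 0 := by
      cases hd : n - ρ with
      | zero =>
        rw [hd, pow_zero, one_mul] at h1
        rw [h1, mul_zero]
      | succ d =>
        rw [hd] at h1
        exact mul_eq_zero_of_pow_succ_mul_eq_zero hA d h1
    rw [hP, mul_smul_comm, h2, smul_zero]
  · refine ⟨(q.coeff 0)⁻¹ • Polynomial.aeval A q.divX, ?_⟩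
    have h : Polynomial.aeval A q = Polynomial.aeval A q.divX * A + q.coeff 0 • 1 := by
      conv_lhs => rw [← Polynomial.divX_mul_X_add q]
      rw [map_add, map_mul, Polynomial.aeval_X, Polynomial.aeval_C,
        Algebra.algebraMap_eq_smul_one]
    rw [hP, h, smul_add, add_comm, smul_smul, inv_mul_cancel₀ hq0, one_smul, smul_mul_assoc]

lemma posDef_add_kernelProjection {A : Matrix (Fin n) (Fin n) ℝ} (hA : A.PosSemidef) {ρ : ℕ}
    (hρ : A.rank = ρ) : (A + kernelProjection (n - ρ) A).PosDef := by
  obtain ⟨hAP, N, hN⟩ := kernelProjection_spec hA.isHermitian hρ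
  have hPt := transpose_kernelProjection (n - ρ) hA.isHermitian
  set P := kernelProjection (n - ρ) A
  have hPP : P * P = P := by
    conv_lhs => rw [hN]
    rw [← hN, hN, add_mul, one_mul, ← hN, mul_assoc, hAP, mul_zero, add_zero]
  have hPs : P.PosSemidef := by
    have := posSemidef_conjTranspose_mul_self P
    rwa [conjTranspose_eq_transpose_of_trivial, hPt, hPP] at this
  refine PosDef.of_dotProduct_mulVec_pos (hA.isHermitian.add hPs.isHermitian) fun {x} hx => ?_
  rw [add_mulVec, dotProduct_add]
  have h1 := hA.dotProduct_mulVec_nonneg x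
  have h2 := hPs.dotProduct_mulVec_nonneg x
  refine lt_of_le_of_ne (add_nonneg h1 h2) fun h => hx ?_
  -- A null vector lies in both kernels, but `1 + N * A` fixes the kernel of `A`, so the vector is
  -- zero.
  have h3 := (hA.dotProduct_mulVec_zero_iff x).mp (by linarith)
  have h4 := (hPs.dotProduct_mulVec_zero_iff x).mp (by linarith)
  rw [hN, add_mulVec, one_mulVec, ← mulVec_mulVec, h3, mulVec_zero, add_zero] at h4
  exact h4

/-- The coefficients are universal polynomials in the entries. -/
lemma contDiffOn_charpoly_coeff {N : ℕ} {A : Euc n → Matrix (Fin N) (Fin N) ℝ}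
    (hA : ∀ i j, ContDiffOn ℝ ∞ (fun x => A x i j) Ω) (k : ℕ) :
    ContDiffOn ℝ ∞ (fun x => (A x).charpoly.coeff k) Ω := by
  have h1 : ∀ p : MvPolynomial (Fin N × Fin N) ℝ,
      ContDiffOn ℝ ∞ (fun x => MvPolynomial.eval (fun ij => A x ij.1 ij.2) p) Ω := fun p => by
    induction p using MvPolynomial.induction_on with
    | C c => simpa using contDiffOn_const
    | add p q hp hq => simpa using hp.add hq
    | mul_X p ij hp => simpa using hp.mul (hA ij.1 ij.2)
  refine (h1 ((charpoly.univ ℝ (Fin N)).coeff k)).congr fun x _ => ?_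
  exact (charpoly.univ_coeff_eval₂Hom (Fin N) (RingHom.id ℝ) (fun ij => A x ij.1 ij.2) k).symm

lemma contDiffOn_matrix_mul {N : ℕ} {A B : Euc n → Matrix (Fin N) (Fin N) ℝ}
    (hA : ∀ i j, ContDiffOn ℝ ∞ (fun x => A x i j) Ω)
    (hB : ∀ i j, ContDiffOn ℝ ∞ (fun x => B x i j) Ω) (i j : Fin N) :
    ContDiffOn ℝ ∞ (fun x => (A x * B x) i j) Ω := by
  simp only [mul_apply]
  exact ContDiffOn.sum fun k _ => (hA i k).mul (hB k j)

lemma contDiffOn_matrix_pow {N : ℕ} {A : Euc n → Matrix (Fin N) (Fin N) ℝ}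
    (hA : ∀ i j, ContDiffOn ℝ ∞ (fun x => A x i j) Ω) :
    ∀ (k : ℕ) (i j : Fin N), ContDiffOn ℝ ∞ (fun x => (A x ^ k) i j) Ω
  | 0, i, j => by simpa using contDiffOn_const
  | k + 1, i, j => by
    simp only [pow_succ]
    exact contDiffOn_matrix_mul (contDiffOn_matrix_pow hA k) hA i j

lemma contDiffOn_kernelProjection {N : ℕ} {A : Euc n → Matrix (Fin N) (Fin N) ℝ}
    (hA : ∀ i j, ContDiffOn ℝ ∞ (fun x => A x i j) Ω) {d : ℕ}
    (hd : ∀ x ∈ Ω, (A x).charpoly.coeff d ≠ 0) (i j : Fin N) :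
    ContDiffOn ℝ ∞ (fun x => kernelProjection d (A x) i j) Ω := by
  simp only [kernelProjection, Matrix.smul_apply, Matrix.sum_apply, smul_eq_mul]
  exact ((contDiffOn_charpoly_coeff hA d).inv hd).mul
    (ContDiffOn.sum fun k _ => (contDiffOn_charpoly_coeff hA _).mul (contDiffOn_matrix_pow hA k i j))

/-- A smooth family of positive definite matrices has a smooth Cholesky factorization. -/
lemma exists_smooth_cholesky : ∀ (N : ℕ) (H : Euc n → Fin N → Fin N → ℝ),
    (∀ i j, ContDiffOn ℝ ∞ (fun x => H x i j) Ω) → (∀ x ∈ Ω, ∀ i j, H x i j = H x j i) →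
    (∀ x ∈ Ω, ∀ ξ : Fin N → ℝ, ξ ≠ 0 → 0 < ∑ i, ∑ j, H x i j * ξ i * ξ j) →
    ∃ L : Euc n → Fin N → Fin N → ℝ, (∀ i j, ContDiffOn ℝ ∞ (fun x => L x i j) Ω) ∧
      ∀ x ∈ Ω, ∀ i j, ∑ k, L x i k * L x j k = H x i j
  | 0, _, _, _, _ => ⟨fun _ _ _ => 0, fun i => i.elim0, fun _ _ i => i.elim0⟩
  | N + 1, H, hs, hsymm, hpos => by
    have hg : ∀ x ∈ Ω, 0 < H x 0 0 := fun x hx => by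
      have := hpos x hx (Fin.cons 1 0) (fun h => by simpa using congrFun h 0)
      simpa [Fin.sum_univ_succ] using this
    -- Induction on the Schur complement of the top left entry. It is positive definite because its
    -- form is the minimum of the full form over the first coordinate, attained at `c`.
    obtain ⟨L, hL, hLH⟩ := exists_smooth_cholesky N
      (fun x i j => H x i.succ j.succ - H x i.succ 0 * H x j.succ 0 / H x 0 0)
      (fun i j => (hs _ _).sub (((hs _ _).mul (hs _ _)).div (hs 0 0) fun x hx => (hg x hx).ne'))
      (fun x hx i j => by rw [hsymm x hx i.succ, mul_comm (H x i.succ 0)])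
      (fun x hx ξ hξ => by
        set c := -(∑ i, H x i.succ 0 * ξ i) / H x 0 0 with hc
        have h1 := hpos x hx (Fin.cons c ξ) (fun h => hξ (by
          funext i
          simpa using congrFun h i.succ))
        have hg0 := (hg x hx).ne'
        set v := ∑ i, H x i.succ 0 * ξ i with hv
        have h2 : ∑ i, ∑ j, H x i.succ 0 * H x j.succ 0 / H x 0 0 * ξ i * ξ j
            = v * v / H x 0 0 := by
          rw [hv, Finset.sum_mul_sum, Finset.sum_div]
          refine Finset.sum_congr rfl fun i _ => ?_
          rw [Finset.sum_div]
          exact Finset.sum_congr rfl fun j _ => by ring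
        have h3 : ∑ j : Fin N, H x 0 j.succ * c * ξ j = c * v := by
          rw [hv, Finset.mul_sum]
          exact Finset.sum_congr rfl fun j _ => by rw [hsymm x hx 0]; ring
        have h4 : ∑ i : Fin N, H x i.succ 0 * ξ i * c = c * v := by
          rw [hv, Finset.mul_sum]
          exact Finset.sum_congr rfl fun j _ => by ring
        simp only [Fin.sum_univ_succ, Fin.cons_zero, Fin.cons_succ, Finset.sum_add_distrib, h3,
          h4] at h1
        simp only [sub_mul, Finset.sum_sub_distrib, h2]
        have h5 : H x 0 0 * c * c + c * v + (c * v) = - (v * v / H x 0 0) := by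
          rw [hc]
          field_simp
          ring
        linarith)
    refine ⟨fun x => Fin.cons (Fin.cons (√(H x 0 0)) fun _ => 0)
      fun i => Fin.cons (H x i.succ 0 / √(H x 0 0)) (L x i), ?_, ?_⟩
    · have hsq : ContDiffOn ℝ ∞ (fun x => √(H x 0 0)) Ω := (hs 0 0).sqrt fun x hx => (hg x hx).ne'
      intro i j
      refine Fin.cases ?_ (fun i => ?_) i <;> refine Fin.cases ?_ (fun j => ?_) j
      · simpa using hsq
      · simpa using contDiffOn_const
      · simp only [Fin.cons_succ, Fin.cons_zero]
        exact (hs _ _).div hsq fun x hx => (Real.sqrt_pos.mpr (hg x hx)).ne'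
      · simpa using hL i j
    · intro x hx i j
      have h1 := Real.mul_self_sqrt (hg x hx).le
      have h2 := (Real.sqrt_pos.mpr (hg x hx)).ne'
      refine Fin.cases ?_ (fun i => ?_) i <;> refine Fin.cases ?_ (fun j => ?_) j
      · simpa [Fin.sum_univ_succ] using h1
      · simp only [Fin.sum_univ_succ, Fin.cons_zero, Fin.cons_succ, zero_mul,
          Finset.sum_const_zero, add_zero, hsymm x hx 0]
        field_simp
      · simp only [Fin.sum_univ_succ, Fin.cons_zero, Fin.cons_succ, mul_zero,
          Finset.sum_const_zero, add_zero]
        field_simp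
      · simp only [Fin.sum_univ_succ, Fin.cons_zero, Fin.cons_succ, hLH x hx]
        rw [div_mul_div_comm, h1]
        ring

/-- A smooth family of positive semidefinite matrices of constant rank factors smoothly
as `B Bᵀ`. -/
lemma exists_smooth_factor {A : Euc n → Matrix (Fin n) (Fin n) ℝ}
    (hs : ∀ i j, ContDiffOn ℝ ∞ (fun x => A x i j) Ω) (hA : ∀ x ∈ Ω, (A x).PosSemidef) {ρ : ℕ}
    (hρ : ∀ x ∈ Ω, (A x).rank = ρ) :
    ∃ B : Euc n → Matrix (Fin n) (Fin n) ℝ, (∀ i j, ContDiffOn ℝ ∞ (fun x => B x i j) Ω) ∧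
      ∀ x ∈ Ω, ∀ i j, ∑ k, B x i k * B x j k = A x i j := by
  have hPs := contDiffOn_kernelProjection hs (d := n - ρ) fun x hx =>
    charpoly_coeff_ne_zero (hA x hx).isHermitian (hρ x hx)
  obtain ⟨L, hL, hLH⟩ := exists_smooth_cholesky n
    (fun x i j => (A x + kernelProjection (n - ρ) (A x)) i j)
    (fun i j => (hs i j).add (hPs i j))
    (fun x hx i j => by
      have := (posDef_add_kernelProjection (hA x hx) (hρ x hx)).isHermitian.apply i j
      simpa using this.symm)
    (fun x hx ξ hξ => by
      have := (posDef_add_kernelProjection (hA x hx) (hρ x hx)).dotProduct_mulVec_pos hξ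
      refine this.trans_eq ?_
      simp only [dotProduct, mulVec, Finset.mul_sum, star_trivial]
      exact Finset.sum_congr rfl fun i _ => Finset.sum_congr rfl fun j _ => by ring)
  -- With `L Lᵀ = A + P`, the product `(1 - P) (A + P) (1 - P)` collapses to `A`, since `P` is a
  -- projection with `A P = P A = 0`.
  refine ⟨fun x => (1 - kernelProjection (n - ρ) (A x)) * Matrix.of (L x),
    contDiffOn_matrix_mul (fun i j => contDiffOn_const.sub (hPs i j)) hL, fun x hx i j => ?_⟩
  obtain ⟨hAP, N, hN⟩ := kernelProjection_spec (hA x hx).isHermitian (hρ x hx)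
  have hPt := transpose_kernelProjection (n - ρ) (hA x hx).isHermitian
  have hAt : (A x)ᵀ = A x := by
    simpa [conjTranspose_eq_transpose_of_trivial] using (hA x hx).isHermitian.eq
  have hLL : Matrix.of (L x) * (Matrix.of (L x))ᵀ = A x + kernelProjection (n - ρ) (A x) := by
    ext i j
    simpa [mul_apply] using hLH x hx i j
  set P := kernelProjection (n - ρ) (A x)
  have hPA : P * A x = 0 := by
    have := congrArg transpose hAP
    rwa [transpose_mul, hPt, hAt, transpose_zero] at this
  have hPP : P * P = P := by
    nth_rewrite 1 [hN]
    rw [add_mul, one_mul, mul_assoc, hAP, mul_zero, add_zero]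
  have key : ((1 - P) * Matrix.of (L x)) * ((1 - P) * Matrix.of (L x))ᵀ = A x := by
    rw [transpose_mul, transpose_sub, transpose_one, hPt, mul_assoc, ← mul_assoc (Matrix.of (L x)),
      hLL, add_mul, mul_sub, mul_sub, hAP, hPP, mul_one, mul_one, sub_self, add_zero, sub_zero,
      sub_mul, one_mul, hPA, sub_zero]
  conv_rhs => rw [← key, mul_apply]
  rfl

end ConstantRank

/-! ### From a smooth factorization to a sum of squares. -/

section SumOfSquares

variable {n : ℕ} {Ω : Set (Euc n)} {e : Fin n → Euc n → Euc n}

lemma fieldDeriv_sum_smul {ι : Type*} (s : Finset ι) (c : ι → Euc n → ℝ)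
    (V : ι → Euc n → Euc n) (f : Euc n → ℝ) (x : Euc n) :
    fieldDeriv (fun x => ∑ i ∈ s, c i x • V i x) f x = ∑ i ∈ s, c i x * fieldDeriv (V i) f x := by
  simp [fieldDeriv, map_sum]

lemma fieldDeriv_fun_sum {ι : Type*} (s : Finset ι) {V : Euc n → Euc n} {f : ι → Euc n → ℝ}
    {x : Euc n} (hf : ∀ i ∈ s, DifferentiableAt ℝ (f i) x) :
    fieldDeriv V (fun z => ∑ i ∈ s, f i z) x = ∑ i ∈ s, fieldDeriv V (f i) x := by
  simp [fieldDeriv, fderiv_fun_sum hf]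

lemma exists_isSumOfSquares (hΩ : IsOpen Ω) (he : ∀ i, ContDiffOn ℝ ∞ (e i) Ω)
    {A : Euc n → Matrix (Fin n) (Fin n) ℝ} (hs : ∀ i j, ContDiffOn ℝ ∞ (fun x => A x i j) Ω)
    (hA : ∀ x ∈ Ω, (A x).PosSemidef) {ρ : ℕ} (hρ : ∀ x ∈ Ω, (A x).rank = ρ) :
    ∃ (X : Fin n → Euc n → Euc n) (Y : Euc n → Euc n), IsSumOfSquares Ω e A X Y := by
  obtain ⟨B, hB, hBA⟩ := exists_smooth_factor hs hA hρ
  -- The fields are the columns of `B` in the frame. Squaring them also differentiates the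
  -- coefficients, and `Y` subtracts the resulting first order terms.
  refine ⟨fun k x => ∑ i, B x i k • e i x,
    fun x => ∑ j, (-∑ k, ∑ i, B x i k * fieldDeriv (e i) (fun z => B z j k) x) • e j x,
    fun k => ContDiffOn.sum fun i _ => (hB i k).smul (he i),
    ContDiffOn.sum fun j _ => ContDiffOn.smul (ContDiffOn.neg (ContDiffOn.sum fun k _ =>
      ContDiffOn.sum fun i _ => (hB i k).mul (contDiffOn_fieldDeriv hΩ (he i) (hB j k)))) (he j),
    fun f hf x hx => ?_⟩
  have hd : ∀ j, DifferentiableAt ℝ (fieldDeriv (e j) f) x := fun j =>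
    differentiableAt_of_contDiffOn hΩ (contDiffOn_fieldDeriv hΩ (he j) hf) hx
  have hdB : ∀ j k, DifferentiableAt ℝ (fun z => B z j k) x := fun j k =>
    differentiableAt_of_contDiffOn hΩ (hB j k) hx
  have h1 : ∀ k, fieldDeriv (fun x => ∑ i, B x i k • e i x)
      (fieldDeriv (fun x => ∑ i, B x i k • e i x) f) x
      = ∑ i, ∑ j, (B x i k * B x j k * fieldDeriv (e i) (fieldDeriv (e j) f) x
        + B x i k * fieldDeriv (e i) (fun z => B z j k) x * fieldDeriv (e j) f x) := fun k => by
    have h2 : fieldDeriv (fun x => ∑ i, B x i k • e i x) f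
        = fun x => ∑ j, B x j k * fieldDeriv (e j) f x := by
      funext z
      exact fieldDeriv_sum_smul _ (fun i z => B z i k) e f z
    rw [h2, fieldDeriv_sum_smul _ (fun i z => B z i k) e]
    refine Finset.sum_congr rfl fun i _ => ?_
    rw [fieldDeriv_fun_sum _ fun j _ => (hdB j k).fun_mul (hd j), Finset.mul_sum]
    refine Finset.sum_congr rfl fun j _ => ?_
    rw [fieldDeriv_mul (hdB j k) (hd j)]
    ring
  have h3 : secondOrderPart e A f x
      = ∑ k, ∑ i, ∑ j, B x i k * B x j k * fieldDeriv (e i) (fieldDeriv (e j) f) x := by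
    simp only [secondOrderPart, ← hBA x hx, Finset.sum_mul]
    symm
    rw [Finset.sum_comm]
    exact Finset.sum_congr rfl fun i _ => Finset.sum_comm
  have h4 : fieldDeriv (fun x => ∑ j, (-∑ k, ∑ i, B x i k *
        fieldDeriv (e i) (fun z => B z j k) x) • e j x) f x
      = -∑ k, ∑ i, ∑ j, B x i k * fieldDeriv (e i) (fun z => B z j k) x * fieldDeriv (e j) f x := by
    rw [fieldDeriv_sum_smul _ (fun j x => -∑ k, ∑ i, B x i k *
        fieldDeriv (e i) (fun z => B z j k) x) e]
    simp only [neg_mul, Finset.sum_mul, Finset.sum_neg_distrib, neg_inj]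
    rw [Finset.sum_comm]
    exact Finset.sum_congr rfl fun k _ => Finset.sum_comm
  rw [h3, h4]
  simp only [h1, Finset.sum_add_distrib]
  ring

end SumOfSquares

/-! ### Assembly of the four statements. -/

lemma differentiable_lower_order {n : ℕ} {Ω : Set (Euc n)} (hΩ : IsOpen Ω)
    {b : Euc n → ℝ → (Fin n → ℝ) → ℝ}
    (hb : ContDiffOn ℝ ∞ (fun q : Euc n × ℝ × (Fin n → ℝ) => b q.1 q.2.1 q.2.2) (Ω ×ˢ Set.univ))
    {x : Euc n} (hx : x ∈ Ω) (p : Fin n → ℝ) : Differentiable ℝ fun z => b x z p := by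
  intro z
  have h1 := (hb.contDiffAt ((hΩ.prod isOpen_univ).mem_nhds
    (Set.mk_mem_prod hx (Set.mem_univ (z, p))))).differentiableAt (by simp)
  exact h1.comp (f := fun z : ℝ => (x, z, p)) z (by fun_prop)

/-- The four conjuncts: the comparison principle for `Q` under the sum-of-squares condition, its
moving frame version, and both with the sum-of-squares condition replaced by constant rank. -/
theorem theoremA (m : ℕ) (hm : 1 ≤ m)
    (Ω : Set (EuclideanSpace ℝ (Fin (m + 1)))) (hΩ_open : IsOpen Ω) (hΩ_conn : IsConnected Ω)
    (a : EuclideanSpace ℝ (Fin (m + 1)) → (Fin (m + 1) → ℝ) →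
      Matrix (Fin (m + 1)) (Fin (m + 1)) ℝ)
    (b : EuclideanSpace ℝ (Fin (m + 1)) → ℝ → (Fin (m + 1) → ℝ) → ℝ)
    (ha_smooth : ∀ i j, ContDiffOn ℝ ∞
      (fun q : EuclideanSpace ℝ (Fin (m + 1)) × (Fin (m + 1) → ℝ) => a q.1 q.2 i j)
      (Ω ×ˢ Set.univ))
    (hb_smooth : ContDiffOn ℝ ∞
      (fun q : EuclideanSpace ℝ (Fin (m + 1)) × ℝ × (Fin (m + 1) → ℝ) => b q.1 q.2.1 q.2.2)
      (Ω ×ˢ Set.univ))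
    (ha_symm : ∀ x ∈ Ω, ∀ p i j, a x p i j = a x p j i)
    (ha_nonneg : ∀ x ∈ Ω, ∀ p, ∀ ξ : Fin (m + 1) → ℝ, 0 ≤ ∑ i, ∑ j, a x p i j * ξ i * ξ j)
    (hb_mono : ∀ x ∈ Ω, ∀ z p, deriv (fun s => b x s p) z ≤ 0) :
    (∀ φ ψ : EuclideanSpace ℝ (Fin (m + 1)) → ℝ,
      ContDiffOn ℝ ∞ φ Ω → ContDiffOn ℝ ∞ ψ Ω →
      (∀ x ∈ Ω, quasilinearOp a b ψ x ≤ quasilinearOp a b φ x) →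
      ∀ (r : ℕ) (X : Fin r → EuclideanSpace ℝ (Fin (m + 1)) → EuclideanSpace ℝ (Fin (m + 1)))
        (Y : EuclideanSpace ℝ (Fin (m + 1)) → EuclideanSpace ℝ (Fin (m + 1))),
        IsSumOfSquares Ω (coordFrame (m + 1)) (frozenCoeff (coordFrame (m + 1)) a φ) X Y →
        MaxPropagates Ω X (fun x => φ x - ψ x)) ∧
    (∀ e : Fin (m + 1) → EuclideanSpace ℝ (Fin (m + 1)) → EuclideanSpace ℝ (Fin (m + 1)),
      IsSmoothFrame Ω e →
      ∀ φ ψ : EuclideanSpace ℝ (Fin (m + 1)) → ℝ,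
      ContDiffOn ℝ ∞ φ Ω → ContDiffOn ℝ ∞ ψ Ω →
      (∀ x ∈ Ω, frameQuasilinearOp e a b ψ x ≤ frameQuasilinearOp e a b φ x) →
      ∀ (r : ℕ) (X : Fin r → EuclideanSpace ℝ (Fin (m + 1)) → EuclideanSpace ℝ (Fin (m + 1)))
        (Y : EuclideanSpace ℝ (Fin (m + 1)) → EuclideanSpace ℝ (Fin (m + 1))),
        IsSumOfSquares Ω e (frozenCoeff e a φ) X Y →
        MaxPropagates Ω X (fun x => φ x - ψ x)) ∧
    (∀ φ : EuclideanSpace ℝ (Fin (m + 1)) → ℝ, ContDiffOn ℝ ∞ φ Ω →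
      ∀ ρ : ℕ, (∀ x ∈ Ω, (frozenCoeff (coordFrame (m + 1)) a φ x).rank = ρ) →
      ∃ (r : ℕ) (X : Fin r → EuclideanSpace ℝ (Fin (m + 1)) → EuclideanSpace ℝ (Fin (m + 1)))
        (Y : EuclideanSpace ℝ (Fin (m + 1)) → EuclideanSpace ℝ (Fin (m + 1))),
        IsSumOfSquares Ω (coordFrame (m + 1)) (frozenCoeff (coordFrame (m + 1)) a φ) X Y ∧
        ∀ ψ : EuclideanSpace ℝ (Fin (m + 1)) → ℝ, ContDiffOn ℝ ∞ ψ Ω →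
          (∀ x ∈ Ω, quasilinearOp a b ψ x ≤ quasilinearOp a b φ x) →
          MaxPropagates Ω X (fun x => φ x - ψ x)) ∧
    (∀ e : Fin (m + 1) → EuclideanSpace ℝ (Fin (m + 1)) → EuclideanSpace ℝ (Fin (m + 1)),
      IsSmoothFrame Ω e →
      ∀ φ : EuclideanSpace ℝ (Fin (m + 1)) → ℝ, ContDiffOn ℝ ∞ φ Ω →
      ∀ ρ : ℕ, (∀ x ∈ Ω, (frozenCoeff e a φ x).rank = ρ) →
      ∃ (r : ℕ) (X : Fin r → EuclideanSpace ℝ (Fin (m + 1)) → EuclideanSpace ℝ (Fin (m + 1)))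
        (Y : EuclideanSpace ℝ (Fin (m + 1)) → EuclideanSpace ℝ (Fin (m + 1))),
        IsSumOfSquares Ω e (frozenCoeff e a φ) X Y ∧
        ∀ ψ : EuclideanSpace ℝ (Fin (m + 1)) → ℝ, ContDiffOn ℝ ∞ ψ Ω →
          (∀ x ∈ Ω, frameQuasilinearOp e a b ψ x ≤ frameQuasilinearOp e a b φ x) →
          MaxPropagates Ω X (fun x => φ x - ψ x)) := by
  have ha : ∀ x ∈ Ω, ∀ p, (a x p).PosSemidef := fun x hx p =>
    posSemidef_of_sum_nonneg (ha_symm x hx p) (ha_nonneg x hx p)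
  have hb : ∀ x ∈ Ω, ∀ p, Antitone fun z => b x z p := fun x hx p =>
    antitone_of_deriv_nonpos (differentiable_lower_order hΩ_open hb_smooth hx p)
      fun z => hb_mono x hx z p
  have main : ∀ e : Fin (m + 1) → EuclideanSpace ℝ (Fin (m + 1)) → EuclideanSpace ℝ (Fin (m + 1)),
      (∀ i, ContDiffOn ℝ ∞ (e i) Ω) → ∀ φ ψ : EuclideanSpace ℝ (Fin (m + 1)) → ℝ,
      ContDiffOn ℝ ∞ φ Ω → ContDiffOn ℝ ∞ ψ Ω →
      (∀ x ∈ Ω, frameQuasilinearOp e a b ψ x ≤ frameQuasilinearOp e a b φ x) →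
      ∀ (r : ℕ) (X : Fin r → EuclideanSpace ℝ (Fin (m + 1)) → EuclideanSpace ℝ (Fin (m + 1)))
        (Y : EuclideanSpace ℝ (Fin (m + 1)) → EuclideanSpace ℝ (Fin (m + 1))),
        IsSumOfSquares Ω e (frozenCoeff e a φ) X Y → MaxPropagates Ω X (fun x => φ x - ψ x) :=
    fun e he φ ψ hφ hψ hQ r X Y hX =>
      maxPropagates_of_isSumOfSquares hΩ_open he ha_smooth hb_smooth ha hb hφ hψ hQ hX
  have hcoord : ∀ i, ContDiffOn ℝ ∞ (coordFrame (m + 1) i) Ω := fun i => contDiffOn_const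
  have rank : ∀ e : Fin (m + 1) → EuclideanSpace ℝ (Fin (m + 1)) → EuclideanSpace ℝ (Fin (m + 1)),
      (∀ i, ContDiffOn ℝ ∞ (e i) Ω) → ∀ φ : EuclideanSpace ℝ (Fin (m + 1)) → ℝ,
      ContDiffOn ℝ ∞ φ Ω → ∀ ρ : ℕ, (∀ x ∈ Ω, (frozenCoeff e a φ x).rank = ρ) →
      ∃ (X : Fin (m + 1) → EuclideanSpace ℝ (Fin (m + 1)) → EuclideanSpace ℝ (Fin (m + 1)))
        (Y : EuclideanSpace ℝ (Fin (m + 1)) → EuclideanSpace ℝ (Fin (m + 1))),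
        IsSumOfSquares Ω e (frozenCoeff e a φ) X Y := fun e he φ hφ ρ hρ =>
    exists_isSumOfSquares hΩ_open he (contDiffOn_frozenCoeff hΩ_open he ha_smooth hφ)
      (fun x hx => ha x hx _) hρ
  refine ⟨main _ hcoord, fun e he => main e he.1, fun φ hφ ρ hρ => ?_, fun e he φ hφ ρ hρ => ?_⟩
  · obtain ⟨X, Y, hXY⟩ := rank _ hcoord φ hφ ρ hρ
    exact ⟨m + 1, X, Y, hXY, fun ψ hψ hQ => main _ hcoord φ ψ hφ hψ hQ _ X Y hXY⟩
  · obtain ⟨X, Y, hXY⟩ := rank e he.1 φ hφ ρ hρ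
    exact ⟨m + 1, X, Y, hXY, fun ψ hψ hQ => main e he.1 φ ψ hφ hψ hQ _ X Y hXY⟩
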